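/- **Theorem (Relative contact invariants for hyperbolic equations).** Let $J^2=J^2(\mathbb R^2,\mathbb R)$ have coordinates $(x,y,z,p,q,r,s,t)$, let $F$ be a smooth function on an open set $D\subset J^2$, and let $i_F:\Sigma_7\to D$ be a smooth map from an open set $\Sigma_7\subset\mathbb R^7$ into the locus $F=0$ that has maximal rank and is transverse to the fibres of $\pi^2_1:J^2\to J^1$. Put $\Delta=F_rF_t-\tfrac14F_s^2$ and $\lambda_+=\tfrac12F_s+\sqrt{|\Delta|}$. Suppose that the equation $F=0$ is hyperbolic, i.e. $i_F^*\Delta<0$, and that $F_s\ge 0$ along $i_F$. Let $I_F=\{\omega^1,\omega^2,\omega^3\}$ be the Pfaffian system on $\Sigma_7$ generated by the pullbacks under $i_F$ of $dz-p\,dx-q\,dy$, $dp-r\,dx-s\,dy$, $dq-s\,dx-t\,dy$, with the symmetric form $\langle\varphi,\psi\rangle_7\,\mathrm{Vol}=d\varphi\wedge d\psi\wedge\omega^1\wedge\omega^2\wedge\omega^3$. For a Pfaffian system $M$ on $\Sigma_7$ let $\mathrm{Char}(M)_u=\{X\in T_u\Sigma_7: X\in M^\perp,\ X\lrcorner dM\subset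 M\}$ be its Cauchy characteristic space at $u$; the class of $M$ at $u$ is the dimension of the annihilator of $\mathrm{Char}(M)_u$. There is a pair of smooth rank two maximally isotropic subsystems $M_1,M_2$ of $I_F$ that are distinct at every point. The equation is called of Monge–Ampère type if $M_1$ and $M_2$ both have class $6$, of Goursat type if one of them has class $6$ and the other one class $7$, and generic if both have class $7$ (at a point, or everywhere on $\Sigma_7$ for fixed $M_1,M_2$). Define functions on $J^2$ near the points of $i_F(\Sigma_7)$ by $$\tilde I_1=\det\begin{pmatrix}F_r&F_s&F_t\\ \lambda_+&F_t&0\\ (F_t/\lambda_+)_r&(F_t/\lambda_+)_s&(F_t/\lambda_+)_t\end{pmatrix},\qquad \tilde I_2=\det\begin{pmatrix}0&F_r&\lambda_+\\ F_r&F_s&F_t\\ (F_r/\lambda_+)_r&(F_r/\lambda_+)_s&(F_r/\lambda_+)_t\end{pmatrix},$$ and put $I_j=i_F^*\tilde I_j$ for $j=1,2$. Then, for every such pair $M_1,M_2$: 1. At each point of $\Sigma_7$ the equation is of Monge–Ampère type iff $I_1=I_2=0$ there, of Goursat type iff exactly one of $I_1,I_2$ is zero there, and generic iff $I_1I_2\ne0$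 there. 2. Consequently, on $\Sigma_7$ the equation is of Monge–Ampère type iff $I_1$ and $I_2$ vanish identically; generic iff $I_1I_2$ vanishes nowhere; and, if $\Sigma_7$ is connected, of Goursat type iff one of $I_1,I_2$ vanishes identically and the other one vanishes nowhere. 3. (Scaling) If $\phi$ is a smooth function on $D$ with $i_F^*\phi>0$ and $\hat F=\phi F$, then $\hat F=0$ is again a hyperbolic equation with parametrization $i_F$ and with $\hat F_s\ge0$ along $i_F$, and $\hat I_j=(i_F^*\phi)^2I_j$ for $j=1,2$. -/

import Mathlib

open scoped ContDiff

noncomputable section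

namespace HypPDE

/-- The jet space `J²(ℝ²,ℝ)` in Monge coordinates `(x, y, z, p, q, r, s, t)`, numbered `0, …, 7`. -/
abbrev Jet2 : Type := Fin 8 → ℝ

/-- The jet space `J¹(ℝ²,ℝ)` in coordinates `(x, y, z, p, q)`. -/
abbrev Jet1 : Type := Fin 5 → ℝ

/-- The parameter space `ℝ⁷`. -/
abbrev Par : Type := Fin 7 → ℝ

/-- The projection `π²₁ : J² → J¹`, `(x, y, z, p, q, r, s, t) ↦ (x, y, z, p, q)`. -/
def proj21 : Jet2 →L[ℝ] Jet1 :=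
  ContinuousLinearMap.pi fun k : Fin 5 =>
    ContinuousLinearMap.proj (R := ℝ) (φ := fun _ : Fin 8 => ℝ) (Fin.castLE (by norm_num) k)

/-- The coordinate differential number `k` on `J²`. -/
def dcoord (k : Fin 8) : Jet2 →L[ℝ] ℝ :=
  ContinuousLinearMap.proj (R := ℝ) (φ := fun _ : Fin 8 => ℝ) k

/-- The partial derivative of `G` along the coordinate number `k` of `J²`. -/
def pd (k : Fin 8) (G : Jet2 → ℝ) (x : Jet2) : ℝ := fderiv ℝ G x (Pi.single k 1)

/-- `G_r` -/
abbrev pr (G : Jet2 → ℝ) : Jet2 → ℝ := pd 5 G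
/-- `G_s` -/
abbrev ps (G : Jet2 → ℝ) : Jet2 → ℝ := pd 6 G
/-- `G_t` -/
abbrev pt (G : Jet2 → ℝ) : Jet2 → ℝ := pd 7 G

/-- `Δ = F_r F_t - F_s² / 4`, as a function on `J²`. -/
def discr (F : Jet2 → ℝ) (x : Jet2) : ℝ := pr F x * pt F x - (1 / 4) * ps F x ^ 2

/-- `λ₊ = F_s / 2 + √|Δ|`. -/
def lamPlus (F : Jet2 → ℝ) (x : Jet2) : ℝ := ps F x / 2 + √|discr F x|

/-- The function `F_t / λ₊` on `J²`. -/
def ratioT (F : Jet2 → ℝ) (x : Jet2) : ℝ := pt F x / lamPlus F x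

/-- The function `F_r / λ₊` on `J²`. -/
def ratioR (F : Jet2 → ℝ) (x : Jet2) : ℝ := pr F x / lamPlus F x

/-- The determinant `Ĩ₁` on `J²`. -/
def tildeI1 (F : Jet2 → ℝ) (x : Jet2) : ℝ :=
  Matrix.det !![pr F x, ps F x, pt F x;
                lamPlus F x, pt F x, 0;
                pr (ratioT F) x, ps (ratioT F) x, pt (ratioT F) x]

/-- The determinant `Ĩ₂` on `J²`. -/
def tildeI2 (F : Jet2 → ℝ) (x : Jet2) : ℝ :=
  Matrix.det !![0, pr F x, lamPlus F x;
                pr F x, ps F x, pt F x;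
                pr (ratioR F) x, ps (ratioR F) x, pt (ratioR F) x]

/-- `I₁ = i_F^* Ĩ₁`. -/
def I1 (F : Jet2 → ℝ) (i : Par → Jet2) (p : Par) : ℝ := tildeI1 F (i p)

/-- `I₂ = i_F^* Ĩ₂`. -/
def I2 (F : Jet2 → ℝ) (i : Par → Jet2) (p : Par) : ℝ := tildeI2 F (i p)

/-- `i : S → J²` is a nondegenerate smooth parametrization, by the open set `S ⊆ ℝ⁷`, of the
equation `F = 0`, where `F` is a smooth function on the open set `D` of `J²`: the map `i` takes
values in the locus `F = 0`, has maximal rank, and is transverse to the fibres of `π²₁`.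
It is not required to cover the whole locus. -/
structure IsNondegParam (F : Jet2 → ℝ) (D : Set Jet2) (S : Set Par) (i : Par → Jet2) : Prop where
  isOpen_dom : IsOpen D
  smooth_fun : ContDiffOn ℝ ∞ F D
  isOpen_par : IsOpen S
  smooth_par : ContDiffOn ℝ ∞ i S
  mem_locus : ∀ p ∈ S, i p ∈ D ∧ F (i p) = 0
  maxRank : ∀ p ∈ S, Function.Injective (fderiv ℝ i p)
  transverse : ∀ p ∈ S,
    LinearMap.range (fderiv ℝ i p : Par →ₗ[ℝ] Jet2) ⊔ LinearMap.ker (proj21 : Jet2 →ₗ[ℝ] Jet1) = ⊤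

/-- A hyperbolic equation with a nondegenerate parametrization: `i_F^* Δ < 0`. -/
structure IsHyperbolic (F : Jet2 → ℝ) (D : Set Jet2) (S : Set Par) (i : Par → Jet2) : Prop
    extends IsNondegParam F D S i where
  discr_neg : ∀ p ∈ S, discr F (i p) < 0

/-- `θ¹ = dz - p dx - q dy`. -/
def theta1 (x : Jet2) : Jet2 →L[ℝ] ℝ := dcoord 2 - x 3 • dcoord 0 - x 4 • dcoord 1
/-- `θ² = dp - r dx - s dy`. -/
def theta2 (x : Jet2) : Jet2 →L[ℝ] ℝ := dcoord 3 - x 5 • dcoord 0 - x 6 • dcoord 1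
/-- `θ³ = dq - s dx - t dy`. -/
def theta3 (x : Jet2) : Jet2 →L[ℝ] ℝ := dcoord 4 - x 6 • dcoord 0 - x 7 • dcoord 1

/-- The pullback `i^* θ` of a 1-form. -/
def pullback (i : Par → Jet2) (θ : Jet2 → Jet2 →L[ℝ] ℝ) (p : Par) : Par →L[ℝ] ℝ :=
  (θ (i p)).comp (fderiv ℝ i p)

/-- The (pointwise) Pfaffian system `I_F` spanned by the pulled back contact forms. -/
def contactSystem (i : Par → Jet2) (p : Par) : Submodule ℝ (Par →L[ℝ] ℝ) :=
  Submodule.span ℝ {pullback i theta1 p, pullback i theta2 p, pullback i theta3 p}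

/-- The exterior derivative of a 1-form on `ℝ⁷`. -/
def dForm (η : Par → Par →L[ℝ] ℝ) (p : Par) : Par [⋀^Fin 2]→L[ℝ] ℝ :=
  extDeriv (fun q => ContinuousAlternatingMap.ofSubsingleton ℝ Par ℝ (0 : Fin 1) (η q)) p

/-- `dη(u, v) = (D_u η)(v) - (D_v η)(u)`. -/
theorem dForm_apply {η : Par → Par →L[ℝ] ℝ} {p : Par} (h : DifferentiableAt ℝ η p) (u v : Par) :
    dForm η p ![u, v] = fderiv ℝ η p u v - fderiv ℝ η p v u := by
  let L : (Par →L[ℝ] ℝ) →L[ℝ] (Par [⋀^Fin 1]→L[ℝ] ℝ) :=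
    (ContinuousAlternatingMap.ofSubsingletonLIE (𝕜 := ℝ) (E := Par) (F := ℝ)
      (0 : Fin 1)).toContinuousLinearEquiv
  have hL : HasFDerivAt (fun q => L (η q)) (L.comp (fderiv ℝ η p)) p :=
    L.hasFDerivAt.comp p h.hasFDerivAt
  have hd : fderiv ℝ (fun q => ContinuousAlternatingMap.ofSubsingleton ℝ Par ℝ (0 : Fin 1) (η q)) p
      = L.comp (fderiv ℝ η p) := hL.fderiv
  rw [dForm, extDeriv, hd]
  simp [ContinuousAlternatingMap.alternatizeUncurryFin_apply, Fin.sum_univ_two, L,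
    Fin.removeNth, sub_eq_add_neg]

/-- The component of the 7-form `a ∧ b ∧ α ∧ β ∧ γ` with respect to the standard volume form of
`ℝ⁷`, i.e. its value on the standard basis (the factor `1 / 4` is `1 / (2! 2! 1! 1! 1!)`). -/
def wedgeCoeff (a b : Par [⋀^Fin 2]→L[ℝ] ℝ) (α β γ : Par →L[ℝ] ℝ) : ℝ :=
  (1 / 4) * ∑ σ : Equiv.Perm (Fin 7), ((Equiv.Perm.sign σ : ℤ) : ℝ) *
    (a ![Pi.single (σ 0) 1, Pi.single (σ 1) 1] * b ![Pi.single (σ 2) 1, Pi.single (σ 3) 1] *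
      α (Pi.single (σ 4) 1) * β (Pi.single (σ 5) 1) * γ (Pi.single (σ 6) 1))

/-- The symmetric form `⟨φ, ψ⟩₇`, defined by `⟨φ, ψ⟩₇ Vol = dφ ∧ dψ ∧ ω¹ ∧ ω² ∧ ω³` with
`ω^α = i^* θ^α` and the standard volume form of `ℝ⁷` (another volume form rescales it). -/
def form7 (i : Par → Jet2) (φ ψ : Par → Par →L[ℝ] ℝ) (p : Par) : ℝ :=
  wedgeCoeff (dForm φ p) (dForm ψ p) (pullback i theta1 p) (pullback i theta2 p)
    (pullback i theta3 p)

/-- `M` is a smooth Pfaffian system of rank `k` on `S`: locally it is spanned by `k` smooth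
pointwise linearly independent 1-forms. -/
def IsPfaffian (S : Set Par) (M : Par → Submodule ℝ (Par →L[ℝ] ℝ)) (k : ℕ) : Prop :=
  ∀ p ∈ S, ∃ V : Set Par, IsOpen V ∧ p ∈ V ∧ V ⊆ S ∧ ∃ η : Fin k → Par → Par →L[ℝ] ℝ,
    (∀ j, ContDiffOn ℝ ∞ (η j) V) ∧
      ∀ q ∈ V, LinearIndependent ℝ (fun j => η j q) ∧
        M q = Submodule.span ℝ (Set.range fun j => η j q)

/-- `φ` is a smooth section over `V` of the Pfaffian system `M`. -/
def IsSection (M : Par → Submodule ℝ (Par →L[ℝ] ℝ)) (V : Set Par) (φ : Par → Par →L[ℝ] ℝ) : Prop :=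
  ContDiffOn ℝ ∞ φ V ∧ ∀ q ∈ V, φ q ∈ M q

/-- `M` is a smooth rank two subsystem of `I_F` that is isotropic for `⟨·,·⟩₇`. For a hyperbolic
equation rank two is the maximal rank of an isotropic subsystem. -/
structure IsIsotropic (S : Set Par) (i : Par → Jet2)
    (M : Par → Submodule ℝ (Par →L[ℝ] ℝ)) : Prop where
  pfaffian : IsPfaffian S M 2
  le_contact : ∀ p ∈ S, M p ≤ contactSystem i p
  isotropic : ∀ V : Set Par, IsOpen V → V ⊆ S → ∀ φ ψ : Par → Par →L[ℝ] ℝ,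
    IsSection M V φ → IsSection M V ψ → ∀ p ∈ V, form7 i φ ψ p = 0

/-- `M₁`, `M₂` is a labelling of the pair of maximally isotropic subsystems of `I_F`. -/
structure IsCharPair (S : Set Par) (i : Par → Jet2)
    (M₁ M₂ : Par → Submodule ℝ (Par →L[ℝ] ℝ)) : Prop where
  isotropic_fst : IsIsotropic S i M₁
  isotropic_snd : IsIsotropic S i M₂
  distinct : ∀ p ∈ S, M₁ p ≠ M₂ p

/-- The Cauchy characteristic space of the Pfaffian system `M` (on `S`) at `p`: the tangent vectors
`v` with `v ∈ M^⊥` and `v ⌟ dη ∈ M` for all local sections `η` of `M` around `p`. -/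
def cauchyChar (S : Set Par) (M : Par → Submodule ℝ (Par →L[ℝ] ℝ)) (p : Par) :
    Submodule ℝ Par where
  carrier := {v | (∀ α ∈ M p, α v = 0) ∧
    ∀ V : Set Par, IsOpen V → p ∈ V → V ⊆ S → ∀ η : Par → Par →L[ℝ] ℝ, IsSection M V η →
      ∃ β ∈ M p, ∀ w : Par, dForm η p ![v, w] = β w}
  zero_mem' := by
    refine ⟨fun α _ => by simp, fun V _ _ _ η _ => ⟨0, Submodule.zero_mem _, fun w => ?_⟩⟩
    rw [(dForm η p).map_coord_zero (0 : Fin 2) rfl]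
    rfl
  add_mem' := by
    rintro u v ⟨hu, hu'⟩ ⟨hv, hv'⟩
    refine ⟨fun α hα => by simp [hu α hα, hv α hα], fun V hV hp hS η hη => ?_⟩
    obtain ⟨β, hβ, hβ'⟩ := hu' V hV hp hS η hη
    obtain ⟨γ, hγ, hγ'⟩ := hv' V hV hp hS η hη
    refine ⟨β + γ, Submodule.add_mem _ hβ hγ, fun w => ?_⟩
    rw [add_apply, ← hβ' w, ← hγ' w]
    exact (dForm η p).toMultilinearMap.cons_add ![w] u v
  smul_mem' := by
    rintro c v ⟨hv, hv'⟩
    refine ⟨fun α hα => by simp [hv α hα], fun V hV hp hS η hη => ?_⟩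
    obtain ⟨β, hβ, hβ'⟩ := hv' V hV hp hS η hη
    refine ⟨c • β, Submodule.smul_mem _ c hβ, fun w => ?_⟩
    rw [smul_apply, ← hβ' w]
    exact (dForm η p).toMultilinearMap.cons_smul ![w] c v

/-- The Cartan system of `M` at `p`: the annihilator of the Cauchy characteristic space. -/
def cartanSystem (S : Set Par) (M : Par → Submodule ℝ (Par →L[ℝ] ℝ)) (p : Par) :
    Submodule ℝ (Par →L[ℝ] ℝ) where
  carrier := {α | ∀ v ∈ cauchyChar S M p, α v = 0}
  zero_mem' := fun v _ => by simp
  add_mem' := fun {α β} hα hβ v hv => by simp [hα v hv, hβ v hv]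
  smul_mem' := fun c α hα v hv => by simp [hα v hv]

/-- The class of `M` at `p`: the rank of its Cartan system there. -/
def classAt (S : Set Par) (M : Par → Submodule ℝ (Par →L[ℝ] ℝ)) (p : Par) : ℕ :=
  Module.finrank ℝ (cartanSystem S M p)

/-- `M` has (constant) class `k` on `S`. -/
def HasClass (S : Set Par) (M : Par → Submodule ℝ (Par →L[ℝ] ℝ)) (k : ℕ) : Prop :=
  ∀ p ∈ S, classAt S M p = k

/-- Monge–Ampère type (6-6) at the point `p`. -/
def IsMongeAmpereAt (S : Set Par) (M₁ M₂ : Par → Submodule ℝ (Par →L[ℝ] ℝ)) (p : Par) : Prop :=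
  classAt S M₁ p = 6 ∧ classAt S M₂ p = 6

/-- Goursat type (6-7) at the point `p`: `{class M₁, class M₂} = {6, 7}`. -/
def IsGoursatAt (S : Set Par) (M₁ M₂ : Par → Submodule ℝ (Par →L[ℝ] ℝ)) (p : Par) : Prop :=
  ({classAt S M₁ p, classAt S M₂ p} : Set ℕ) = {6, 7}

/-- Generic type (7-7) at the point `p`. -/
def IsGenericAt (S : Set Par) (M₁ M₂ : Par → Submodule ℝ (Par →L[ℝ] ℝ)) (p : Par) : Prop :=
  classAt S M₁ p = 7 ∧ classAt S M₂ p = 7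

/-- Monge–Ampère type (6-6) on `S`. -/
def IsMongeAmpere (S : Set Par) (M₁ M₂ : Par → Submodule ℝ (Par →L[ℝ] ℝ)) : Prop :=
  HasClass S M₁ 6 ∧ HasClass S M₂ 6

/-- Goursat type (6-7) on `S`: one of the two systems has class 6 and the other one class 7. -/
def IsGoursat (S : Set Par) (M₁ M₂ : Par → Submodule ℝ (Par →L[ℝ] ℝ)) : Prop :=
  (HasClass S M₁ 6 ∧ HasClass S M₂ 7) ∨ (HasClass S M₁ 7 ∧ HasClass S M₂ 6)

/-- Generic type (7-7) on `S`. -/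
def IsGeneric (S : Set Par) (M₁ M₂ : Par → Submodule ℝ (Par →L[ℝ] ℝ)) : Prop :=
  HasClass S M₁ 7 ∧ HasClass S M₂ 7

end HypPDE

end

noncomputable section

namespace HypPDE

open Filter Topology Module

/-! Modulo `ω¹, ω², ω³` one has `dω¹ ≡ 0`, `dω² ≡ dx∧dr + dy∧ds` and `dω³ ≡ dx∧ds + dy∧dt`. For `φ`
with coefficients `(a, b)` along `ω², ω³`, the number `⟨φ,φ⟩₇` is therefore quadratic in `(a, b)`,
with coefficients built from the wedges of `dr, ds, dt`. The relation `F_r dr + F_s ds + F_t dt ≡ 0`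
modulo `dx, dy, ω¹, ω², ω³` turns it into a nonzero multiple of `F_t a² - F_s a b + F_r b²`
(`exists_form7_eq`). Hyperbolicity and `F_s ≥ 0` split this form as `λ₊ (τ a - b)(a - ρ b)`, where
`τ = F_t/λ₊`, `ρ = F_r/λ₊` and `ρτ ≠ 1` (`symbol_factorization`, `ratioR_mul_ratioT_ne_one`). Hence
the only isotropic rank two subsystems at a point are `⟨ω¹, ω² + τ ω³⟩` and `⟨ω¹, ρ ω² + ω³⟩`
(`IsIsotropic.eq_or_eq`), and they are distinct.

A Cauchy characteristic vector of `⟨ω¹, a ω² + b ω³⟩` must be vertical and proportional to `(b², -a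
b, a²)` in the `r, s, t` directions, a direction tangent to the equation exactly because `(a, b)` is
null. Such a nonzero vector `v` is characteristic iff the line `[a : b]` is stationary along it,
that is `a db(v) = b da(v)`; the class is then 6, and otherwise 7 (`classAt_charSystem`). For the
two systems this condition reads `dτ(v) = 0` and `dρ(v) = 0`. The determinants are these derivatives
up to the factor `-λ₊²` (`exists_I1_eq`, `exists_I2_eq`). The same formulas give scaling: along `i`
the ratios do not change and `λ₊` is multiplied by `φ`. -/

/-! ### Smooth coefficients and exterior derivatives of combinations of 1-forms. -/

/-- A section of the span of a smooth frame of covector fields has smooth coefficients. -/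
theorem exists_smooth_coeffs {E : Type*} [NormedAddCommGroup E] [NormedSpace ℝ E] {n : ℕ}
    {e : Fin n → E → E →L[ℝ] ℝ} {η : E → E →L[ℝ] ℝ} {p : E}
    (he : ∀ k, ContDiffAt ℝ ∞ (e k) p) (hη : ContDiffAt ℝ ∞ η p)
    (u : Fin n → E) (hu : ∀ k j, e k p (u j) = if j = k then 1 else 0)
    (hmem : ∀ᶠ q in 𝓝 p, η q ∈ Submodule.span ℝ (Set.range fun k => e k q)) :
    ∃ c : Fin n → E → ℝ, (∀ k, ContDiffAt ℝ ∞ (c k) p) ∧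
      ∀ᶠ q in 𝓝 p, η q = ∑ k, c k q • e k q := by
  -- `G q` is the matrix of values of the frame on the fixed vectors `u j`. It is the identity at
  -- `p`, hence invertible with smooth inverse nearby, and it sends the coefficients of `η q` to the
  -- values `η q (u j)`.
  let G : E → (Fin n → ℝ) →L[ℝ] (Fin n → ℝ) := fun q => ∑ j, ∑ k, (e k q (u j)) •
    (ContinuousLinearMap.proj (R := ℝ) (φ := fun _ : Fin n => ℝ) k).smulRight
      (Pi.single j (1 : ℝ) : Fin n → ℝ)
  have hG : ∀ q c j, G q c j = ∑ k, c k * e k q (u j) := by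
    intro q c j
    simp only [G, sum_apply, smul_apply,
      ContinuousLinearMap.smulRight_apply, ContinuousLinearMap.proj_apply, Finset.sum_apply,
      Pi.smul_apply, Pi.single_apply, smul_eq_mul]
    rw [Finset.sum_eq_single j]
    · exact Finset.sum_congr rfl fun k _ => by rw [if_pos rfl]; ring
    · intro b _ hb
      exact Finset.sum_eq_zero fun k _ => by rw [if_neg (Ne.symm hb)]; ring
    · simp
  have hGp : G p = (ContinuousLinearEquiv.refl ℝ (Fin n → ℝ) : _ →L[ℝ] _) := by
    ext c j
    rw [hG]
    simp [hu]
  have hGs : ContDiffAt ℝ ∞ G p := by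
    refine ContDiffAt.sum fun j _ => ContDiffAt.sum fun k _ => ?_
    exact ((he k).clm_apply contDiffAt_const).smul contDiffAt_const
  have hinv : ContDiffAt ℝ ∞ (fun q => (G q).inverse) p := by
    have h : ContDiffAt ℝ ∞ ContinuousLinearMap.inverse (G p) := by
      rw [hGp]
      exact contDiffAt_map_inverse _
    exact h.comp p hGs
  refine ⟨fun k q => (G q).inverse (fun j => η q (u j)) k, fun k => ?_, ?_⟩
  · refine contDiffAt_pi.1 (hinv.clm_apply (contDiffAt_pi.2 fun j => ?_)) k
    exact hη.clm_apply contDiffAt_const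
  · have hn : ∀ᶠ q in 𝓝 p, G q ∈ Set.range
        ((↑) : ((Fin n → ℝ) ≃L[ℝ] (Fin n → ℝ)) → (Fin n → ℝ) →L[ℝ] (Fin n → ℝ)) :=
      hGs.continuousAt (hGp ▸ ContinuousLinearEquiv.nhds _)
    filter_upwards [hn, hmem] with q hq hm
    obtain ⟨c, hc⟩ := (Submodule.mem_span_range_iff_exists_fun ℝ).1 hm
    obtain ⟨g, hg⟩ := hq
    have h1 : (fun j => η q (u j)) = G q c := by
      ext j
      rw [hG, ← hc]
      simp
    have h2 : (G q).inverse (G q c) = c := by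
      rw [← hg, ContinuousLinearMap.inverse_equiv]
      simp
    rw [h1, h2, hc]

theorem linearIndependent_of_dual {E : Type*} [NormedAddCommGroup E] [NormedSpace ℝ E] {n : ℕ}
    {e : Fin n → E →L[ℝ] ℝ} {u : Fin n → E} (hu : ∀ k j, e k (u j) = if j = k then 1 else 0) :
    LinearIndependent ℝ e := by
  rw [Fintype.linearIndependent_iff]
  intro g hg j
  have := DFunLike.congr_fun hg (u j)
  simpa [hu] using this

theorem dForm_congr {η η' : Par → Par →L[ℝ] ℝ} {p : Par} (h : η =ᶠ[𝓝 p] η')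
    (hd : DifferentiableAt ℝ η' p) (u v : Par) : dForm η p ![u, v] = dForm η' p ![u, v] := by
  rw [dForm_apply hd, dForm_apply (hd.congr_of_eventuallyEq h), h.fderiv_eq]

theorem dForm_sum_smul {n : ℕ} {c : Fin n → Par → ℝ} {e : Fin n → Par → Par →L[ℝ] ℝ} {p : Par}
    (hc : ∀ k, DifferentiableAt ℝ (c k) p) (he : ∀ k, DifferentiableAt ℝ (e k) p) (u v : Par) :
    dForm (fun q => ∑ k, c k q • e k q) p ![u, v] =
      ∑ k, (c k p * dForm (e k) p ![u, v] + fderiv ℝ (c k) p u * e k p v -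
        fderiv ℝ (c k) p v * e k p u) := by
  have h : HasFDerivAt (fun q => ∑ k, c k q • e k q)
      (∑ k, (c k p • fderiv ℝ (e k) p + (fderiv ℝ (c k) p).smulRight (e k p))) p :=
    HasFDerivAt.fun_sum fun k _ => (hc k).hasFDerivAt.smul (he k).hasFDerivAt
  rw [dForm_apply h.differentiableAt, h.fderiv]
  simp only [sum_apply, ← Finset.sum_sub_distrib]
  refine Finset.sum_congr rfl fun k _ => ?_
  rw [dForm_apply (he k)]
  simp only [add_apply, smul_apply,
    ContinuousLinearMap.smulRight_apply, smul_eq_mul]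
  ring

/-! ### Pullbacks of the contact forms and their structure equations. -/

theorem contDiffAt_pullback {i : Par → Jet2} {θ : Jet2 → Jet2 →L[ℝ] ℝ} {p : Par}
    (hi : ContDiffAt ℝ ∞ i p) (hθ : ContDiffAt ℝ ∞ θ (i p)) : ContDiffAt ℝ ∞ (pullback i θ) p := by
  have h1 : ContDiffAt ℝ ∞ (fun q => θ (i q)) p := hθ.comp p hi
  have h2 : ContDiffAt ℝ ∞ (fderiv ℝ i) p := hi.fderiv_right (by simp)
  exact h1.clm_comp h2

/-- The second derivative of `i` is symmetric and cancels in the antisymmetrization, so `d` commutes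
with pullback. -/
theorem dForm_pullback {i : Par → Jet2} {θ : Jet2 → Jet2 →L[ℝ] ℝ} {p : Par}
    {θ' : Jet2 →L[ℝ] Jet2 →L[ℝ] ℝ} (hi : ContDiffAt ℝ ∞ i p) (hθ : HasFDerivAt θ θ' (i p))
    (u v : Par) : dForm (pullback i θ) p ![u, v] =
      θ' (fderiv ℝ i p u) (fderiv ℝ i p v) - θ' (fderiv ℝ i p v) (fderiv ℝ i p u) := by
  have h1 : HasFDerivAt i (fderiv ℝ i p) p := (hi.differentiableAt (by simp)).hasFDerivAt
  have h2 : HasFDerivAt (fderiv ℝ i) (fderiv ℝ (fderiv ℝ i) p) p := by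
    have : ContDiffAt ℝ ∞ (fderiv ℝ i) p := hi.fderiv_right (by simp)
    exact (this.differentiableAt (by simp)).hasFDerivAt
  have h3 := (hθ.comp p h1).clm_comp h2
  have hs : fderiv ℝ (fderiv ℝ i) p u v = fderiv ℝ (fderiv ℝ i) p v u :=
    (hi.isSymmSndFDerivAt (by simpa using WithTop.coe_le_coe.2 (le_top : (2 : ℕ∞) ≤ ⊤))) u v
  have h4 : HasFDerivAt (pullback i θ) _ p := h3
  rw [dForm_apply h4.differentiableAt, h4.fderiv]
  simp [hs]

theorem contDiff_theta1 : ContDiff ℝ ∞ theta1 := by unfold theta1; fun_prop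
theorem contDiff_theta2 : ContDiff ℝ ∞ theta2 := by unfold theta2; fun_prop
theorem contDiff_theta3 : ContDiff ℝ ∞ theta3 := by unfold theta3; fun_prop

@[simp] theorem dcoord_apply (k : Fin 8) (X : Jet2) : dcoord k X = X k := rfl

theorem hasFDerivAt_contact (k l m : Fin 8) (x : Jet2) :
    HasFDerivAt (fun x : Jet2 => dcoord k - x l • dcoord 0 - x m • dcoord 1)
      (-((dcoord l).smulRight (dcoord 0)) - (dcoord m).smulRight (dcoord 1)) x := by
  have h1 : HasFDerivAt (fun x : Jet2 => x l • dcoord 0) ((dcoord l).smulRight (dcoord 0)) x :=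
    (dcoord l).hasFDerivAt.smul_const (dcoord 0)
  have h2 : HasFDerivAt (fun x : Jet2 => x m • dcoord 1) ((dcoord m).smulRight (dcoord 1)) x :=
    (dcoord m).hasFDerivAt.smul_const (dcoord 1)
  have := ((hasFDerivAt_const (dcoord k) x).sub h1).sub h2
  rwa [zero_sub] at this

theorem dForm_theta1 {i : Par → Jet2} {p : Par} (hi : ContDiffAt ℝ ∞ i p) (u v : Par) :
    dForm (pullback i theta1) p ![u, v] =
      fderiv ℝ i p v 3 * fderiv ℝ i p u 0 + fderiv ℝ i p v 4 * fderiv ℝ i p u 1 -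
      fderiv ℝ i p u 3 * fderiv ℝ i p v 0 - fderiv ℝ i p u 4 * fderiv ℝ i p v 1 := by
  rw [dForm_pullback (θ := theta1) hi (hasFDerivAt_contact 2 3 4 (i p))]
  simp
  ring

theorem dForm_theta2 {i : Par → Jet2} {p : Par} (hi : ContDiffAt ℝ ∞ i p) (u v : Par) :
    dForm (pullback i theta2) p ![u, v] =
      fderiv ℝ i p v 5 * fderiv ℝ i p u 0 + fderiv ℝ i p v 6 * fderiv ℝ i p u 1 -
      fderiv ℝ i p u 5 * fderiv ℝ i p v 0 - fderiv ℝ i p u 6 * fderiv ℝ i p v 1 := by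
  rw [dForm_pullback (θ := theta2) hi (hasFDerivAt_contact 3 5 6 (i p))]
  simp
  ring

theorem dForm_theta3 {i : Par → Jet2} {p : Par} (hi : ContDiffAt ℝ ∞ i p) (u v : Par) :
    dForm (pullback i theta3) p ![u, v] =
      fderiv ℝ i p v 6 * fderiv ℝ i p u 0 + fderiv ℝ i p v 7 * fderiv ℝ i p u 1 -
      fderiv ℝ i p u 6 * fderiv ℝ i p v 0 - fderiv ℝ i p u 7 * fderiv ℝ i p v 1 := by
  rw [dForm_pullback (θ := theta3) hi (hasFDerivAt_contact 4 6 7 (i p))]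
  simp
  ring

theorem pullback_theta1_apply (i : Par → Jet2) (p v : Par) : pullback i theta1 p v =
    fderiv ℝ i p v 2 - i p 3 * fderiv ℝ i p v 0 - i p 4 * fderiv ℝ i p v 1 := by
  simp [pullback, theta1]

theorem pullback_theta2_apply (i : Par → Jet2) (p v : Par) : pullback i theta2 p v =
    fderiv ℝ i p v 3 - i p 5 * fderiv ℝ i p v 0 - i p 6 * fderiv ℝ i p v 1 := by
  simp [pullback, theta2]

theorem pullback_theta3_apply (i : Par → Jet2) (p v : Par) : pullback i theta3 p v =
    fderiv ℝ i p v 4 - i p 6 * fderiv ℝ i p v 0 - i p 7 * fderiv ℝ i p v 1 := by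
  simp [pullback, theta3]

/-! ### Seven-fold wedge products. -/

section
variable {E : Type*} [AddCommGroup E] [Module ℝ E] (g : E [⋀^Fin 7]→ₗ[ℝ] ℝ)

theorem wedge_swap01 (a b c d α β γ : E) :
    g ![b, a, c, d, α, β, γ] = -g ![a, b, c, d, α, β, γ] := by
  rw [← g.map_swap ![a, b, c, d, α, β, γ] (show (0 : Fin 7) ≠ 1 by decide)]
  congr 1
  funext k
  fin_cases k <;> rfl

theorem wedge_swap23 (a b c d α β γ : E) :
    g ![a, b, d, c, α, β, γ] = -g ![a, b, c, d, α, β, γ] := by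
  rw [← g.map_swap ![a, b, c, d, α, β, γ] (show (2 : Fin 7) ≠ 3 by decide)]
  congr 1
  funext k
  fin_cases k <;> rfl

theorem wedge_swap13 (a b c d α β γ : E) :
    g ![a, d, c, b, α, β, γ] = -g ![a, b, c, d, α, β, γ] := by
  rw [← g.map_swap ![a, b, c, d, α, β, γ] (show (1 : Fin 7) ≠ 3 by decide)]
  congr 1
  funext k
  fin_cases k <;> rfl

theorem wedge_swap02 (a b c d α β γ : E) :
    g ![c, b, a, d, α, β, γ] = -g ![a, b, c, d, α, β, γ] := by
  rw [← g.map_swap ![a, b, c, d, α, β, γ] (show (0 : Fin 7) ≠ 2 by decide)]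
  congr 1
  funext k
  fin_cases k <;> rfl

/-- The alternating bilinear form `(X, Y) ↦ δ ∧ X ∧ ε ∧ Y ∧ α ∧ β ∧ γ`. -/
def crossForm (δ ε α β γ : E) : E →ₗ[ℝ] E →ₗ[ℝ] ℝ :=
  have h1 : ∀ X Y, ![δ, X, ε, Y, α, β, γ] = Function.update ![δ, 0, ε, Y, α, β, γ] 1 X := by
    intro X Y; funext k; fin_cases k <;> rfl
  have h3 : ∀ X Y, ![δ, X, ε, Y, α, β, γ] = Function.update ![δ, X, ε, 0, α, β, γ] 3 Y := by
    intro X Y; funext k; fin_cases k <;> rfl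
  LinearMap.mk₂ ℝ (fun X Y => g ![δ, X, ε, Y, α, β, γ])
    (fun X X' Y => by
      rw [h1 (X + X'), h1 X, h1 X']; exact g.map_update_add _ _ _ _)
    (fun c X Y => by rw [h1 (c • X), h1 X]; exact g.map_update_smul _ _ _ _)
    (fun X Y Y' => by
      rw [h3 X (Y + Y'), h3 X Y, h3 X Y']; exact g.map_update_add _ _ _ _)
    (fun c X Y => by rw [h3 X (c • Y), h3 X Y]; exact g.map_update_smul _ _ _ _)

theorem crossForm_apply (δ ε α β γ X Y : E) :
    crossForm g δ ε α β γ X Y = g ![δ, X, ε, Y, α, β, γ] := rfl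

theorem crossForm_self (δ ε α β γ X : E) : crossForm g δ ε α β γ X X = 0 :=
  g.map_eq_zero_of_eq (i := 1) (j := 3) _ rfl (by decide)

theorem crossForm_neg_swap (δ ε α β γ X Y : E) :
    crossForm g δ ε α β γ Y X = -crossForm g δ ε α β γ X Y :=
  wedge_swap13 g _ _ _ _ _ _ _

theorem crossForm_right_eq_zero (δ ε α β γ X Y : E) (h : Y = δ ∨ Y = ε ∨ Y = α ∨ Y = β ∨ Y = γ) :
    crossForm g δ ε α β γ X Y = 0 := by
  rw [crossForm_apply]
  rcases h with rfl | rfl | rfl | rfl | rfl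
  · exact g.map_eq_zero_of_eq (i := 0) (j := 3) _ rfl (by decide)
  · exact g.map_eq_zero_of_eq (i := 2) (j := 3) _ rfl (by decide)
  · exact g.map_eq_zero_of_eq (i := 3) (j := 4) _ rfl (by decide)
  · exact g.map_eq_zero_of_eq (i := 3) (j := 5) _ rfl (by decide)
  · exact g.map_eq_zero_of_eq (i := 3) (j := 6) _ rfl (by decide)

/-- The sum expands the wedge of two 2-forms `δ∧ζ₀ + ε∧ζ₁ + …` with `α∧β∧γ`. Terms carrying an extra
`α`, `β` or `γ` vanish, and so do those repeating `δ` or `ε`; only the two mixed terms survive. -/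
theorem sum_wedge_eq_crossForm
    (δ ε α β γ ζ₀ ζ₁ κ₁ κ₂ κ₃ ζ₀' ζ₁' κ₁' κ₂' κ₃' : E) :
    ∑ k, ∑ l, g ![![δ, ε, κ₁, κ₂, κ₃] k, ![ζ₀, ζ₁, α, β, γ] k, ![δ, ε, κ₁', κ₂', κ₃'] l,
      ![ζ₀', ζ₁', α, β, γ] l, α, β, γ] =
      crossForm g δ ε α β γ ζ₀ ζ₁' + crossForm g δ ε α β γ ζ₀' ζ₁ := by
  have h14 : ∀ x y z, g ![x, α, y, z, α, β, γ] = 0 := fun x y z =>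
    g.map_eq_zero_of_eq (i := 1) (j := 4) _ rfl (by decide)
  have h15 : ∀ x y z, g ![x, β, y, z, α, β, γ] = 0 := fun x y z =>
    g.map_eq_zero_of_eq (i := 1) (j := 5) _ rfl (by decide)
  have h16 : ∀ x y z, g ![x, γ, y, z, α, β, γ] = 0 := fun x y z =>
    g.map_eq_zero_of_eq (i := 1) (j := 6) _ rfl (by decide)
  have h34 : ∀ x y z, g ![x, y, z, α, α, β, γ] = 0 := fun x y z =>
    g.map_eq_zero_of_eq (i := 3) (j := 4) _ rfl (by decide)
  have h35 : ∀ x y z, g ![x, y, z, β, α, β, γ] = 0 := fun x y z =>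
    g.map_eq_zero_of_eq (i := 3) (j := 5) _ rfl (by decide)
  have h36 : ∀ x y z, g ![x, y, z, γ, α, β, γ] = 0 := fun x y z =>
    g.map_eq_zero_of_eq (i := 3) (j := 6) _ rfl (by decide)
  have h02 : ∀ x y z, g ![x, y, x, z, α, β, γ] = 0 := fun x y z =>
    g.map_eq_zero_of_eq (i := 0) (j := 2) _ rfl (by decide)
  have hsw : g ![ε, ζ₁, δ, ζ₀', α, β, γ] = g ![δ, ζ₀', ε, ζ₁, α, β, γ] := by
    rw [wedge_swap02 g δ ζ₁ ε ζ₀', wedge_swap13 g δ ζ₀' ε ζ₁, neg_neg]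
  simp only [Fin.sum_univ_five, crossForm_apply]
  simp [h14, h15, h16, h34, h35, h36, h02, hsw]

end

/-- The components of a covector. -/
def stdCoeffs : (Par →L[ℝ] ℝ) →ₗ[ℝ] (Fin 7 → ℝ) where
  toFun α j := α (Pi.single j 1)
  map_add' _ _ := rfl
  map_smul' _ _ := rfl

/-- The value on the standard basis of the wedge product of seven covectors. -/
def rowDet : (Par →L[ℝ] ℝ) [⋀^Fin 7]→ₗ[ℝ] ℝ := Matrix.detRowAlternating.compLinearMap stdCoeffs

theorem rowDet_eq_det (ξ : Fin 7 → Par →L[ℝ] ℝ) :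
    rowDet ξ = (Matrix.of fun k j => ξ k (Pi.single j 1)).det := by
  unfold rowDet
  rw [AlternatingMap.compLinearMap_apply]
  have : (Matrix.of fun k j => ξ k (Pi.single j 1)) = fun k => stdCoeffs (ξ k) := by
    ext k j; rfl
  rw [this]
  generalize (fun k => stdCoeffs (ξ k)) = m
  rfl

theorem rowDet_cons (a b c d α β γ : Par →L[ℝ] ℝ) :
    rowDet ![a, b, c, d, α, β, γ] = ∑ σ : Equiv.Perm (Fin 7), ((Equiv.Perm.sign σ : ℤ) : ℝ) *
      (a (Pi.single (σ 0) 1) * b (Pi.single (σ 1) 1) * c (Pi.single (σ 2) 1) *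
        d (Pi.single (σ 3) 1) * α (Pi.single (σ 4) 1) * β (Pi.single (σ 5) 1) *
        γ (Pi.single (σ 6) 1)) := by
  rw [rowDet_eq_det, ← Matrix.det_transpose, Matrix.det_apply']
  refine Finset.sum_congr rfl fun σ _ => ?_
  rw [Fin.prod_univ_seven]
  rfl

theorem wedgeCoeff_eq_sum_rowDet {n : ℕ} {a b : Par [⋀^Fin 2]→L[ℝ] ℝ} (α β γ : Par →L[ℝ] ℝ)
    {ξ η ξ' η' : Fin n → Par →L[ℝ] ℝ}
    (ha : ∀ u v, a ![u, v] = ∑ k, (ξ k u * η k v - ξ k v * η k u))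
    (hb : ∀ u v, b ![u, v] = ∑ k, (ξ' k u * η' k v - ξ' k v * η' k u)) :
    wedgeCoeff a b α β γ = ∑ k, ∑ l, rowDet ![ξ k, η k, ξ' l, η' l, α, β, γ] := by
  -- Writing each 2-form as an antisymmetrized product produces four signed, equal terms; this
  -- absorbs the factor `1 / 4` of `wedgeCoeff`.
  have key : ∀ k l, rowDet ![ξ k, η k, ξ' l, η' l, α, β, γ] = (1 / 4) *
      (rowDet ![ξ k, η k, ξ' l, η' l, α, β, γ] - rowDet ![η k, ξ k, ξ' l, η' l, α, β, γ] -
        rowDet ![ξ k, η k, η' l, ξ' l, α, β, γ] + rowDet ![η k, ξ k, η' l, ξ' l, α, β, γ]) := by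
    intro k l
    rw [wedge_swap01 rowDet (ξ k) (η k) (η' l), wedge_swap23 rowDet (ξ k) (η k) (ξ' l),
      wedge_swap01 rowDet (ξ k) (η k) (ξ' l)]
    ring
  rw [Finset.sum_congr rfl fun k _ => Finset.sum_congr rfl fun l _ => key k l]
  simp only [← Finset.mul_sum]
  unfold wedgeCoeff
  congr 1
  simp only [rowDet_cons, ← Finset.sum_sub_distrib, ← Finset.sum_add_distrib]
  rw [Finset.sum_congr rfl fun k _ => Finset.sum_comm, Finset.sum_comm]
  refine Finset.sum_congr rfl fun σ _ => ?_
  rw [ha, hb, Finset.sum_mul_sum, Finset.sum_mul, Finset.sum_mul, Finset.sum_mul, Finset.mul_sum]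
  refine Finset.sum_congr rfl fun k _ => ?_
  rw [Finset.sum_mul, Finset.sum_mul, Finset.sum_mul, Finset.mul_sum]
  refine Finset.sum_congr rfl fun l _ => ?_
  ring

theorem rowDet_ne_zero {ξ : Fin 7 → Par →L[ℝ] ℝ} (h : ∀ v : Par, (∀ k, ξ k v = 0) → v = 0) :
    rowDet ξ ≠ 0 := by
  rw [rowDet_eq_det]
  intro h0
  obtain ⟨v, hv, hv'⟩ := Matrix.exists_mulVec_eq_zero_iff.2 h0
  refine hv (h v fun k => ?_)
  have h1 := congrFun hv' k
  have h2 : v = ∑ j, v j • (Pi.single j 1 : Par) := by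
    ext l
    simp [Finset.sum_apply, Pi.single_apply]
  rw [h2, map_sum]
  simp only [Matrix.mulVec, dotProduct, Matrix.of_apply, Pi.zero_apply] at h1
  rw [← h1]
  exact Finset.sum_congr rfl fun j _ => by rw [map_smul, smul_eq_mul, mul_comm]

theorem wedgeCoeff_eq_crossForm {a b : Par [⋀^Fin 2]→L[ℝ] ℝ}
    (δ ε α β γ ζ₀ ζ₁ κ₁ κ₂ κ₃ ζ₀' ζ₁' κ₁' κ₂' κ₃' : Par →L[ℝ] ℝ)
    (ha : ∀ u v, a ![u, v] = δ u * ζ₀ v - δ v * ζ₀ u + (ε u * ζ₁ v - ε v * ζ₁ u) +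
      (κ₁ u * α v - κ₁ v * α u) + (κ₂ u * β v - κ₂ v * β u) + (κ₃ u * γ v - κ₃ v * γ u))
    (hb : ∀ u v, b ![u, v] = δ u * ζ₀' v - δ v * ζ₀' u + (ε u * ζ₁' v - ε v * ζ₁' u) +
      (κ₁' u * α v - κ₁' v * α u) + (κ₂' u * β v - κ₂' v * β u) + (κ₃' u * γ v - κ₃' v * γ u)) :
    wedgeCoeff a b α β γ =
      crossForm rowDet δ ε α β γ ζ₀ ζ₁' + crossForm rowDet δ ε α β γ ζ₀' ζ₁ := by
  rw [← sum_wedge_eq_crossForm rowDet δ ε α β γ ζ₀ ζ₁ κ₁ κ₂ κ₃ ζ₀' ζ₁' κ₁' κ₂' κ₃']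
  refine wedgeCoeff_eq_sum_rowDet α β γ (fun u v => ?_) (fun u v => ?_)
  · rw [ha, Fin.sum_univ_five]; rfl
  · rw [hb, Fin.sum_univ_five]; rfl

/-! ### Tangent vectors of the equation and the form `⟨·,·⟩₇` on the contact system. -/

section

variable {F : Jet2 → ℝ} {D : Set Jet2} {S : Set Par} {i : Par → Jet2} {p : Par}

theorem IsNondegParam.contDiffAt_par (hF : IsNondegParam F D S i) (hp : p ∈ S) :
    ContDiffAt ℝ ∞ i p :=
  hF.smooth_par.contDiffAt (hF.isOpen_par.mem_nhds hp)

theorem IsNondegParam.contDiffAt_fun (hF : IsNondegParam F D S i) (hp : p ∈ S) :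
    ContDiffAt ℝ ∞ F (i p) :=
  hF.smooth_fun.contDiffAt (hF.isOpen_dom.mem_nhds (hF.mem_locus p hp).1)

theorem fderiv_eq_sum_pd (G : Jet2 → ℝ) (x X : Jet2) :
    fderiv ℝ G x X = ∑ k, X k * pd k G x := by
  have h2 : X = ∑ j, X j • (Pi.single j 1 : Jet2) := by
    ext l
    simp [Finset.sum_apply, Pi.single_apply]
  conv_lhs => rw [h2]
  simp [pd]

theorem IsNondegParam.fderiv_fun_fderiv_par (hF : IsNondegParam F D S i) (hp : p ∈ S) (v : Par) :
    fderiv ℝ F (i p) (fderiv ℝ i p v) = 0 := by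
  have h1 : HasFDerivAt (fun q => F (i q)) ((fderiv ℝ F (i p)).comp (fderiv ℝ i p)) p :=
    ((hF.contDiffAt_fun hp).differentiableAt (by simp)).hasFDerivAt.comp p
      ((hF.contDiffAt_par hp).differentiableAt (by simp)).hasFDerivAt
  have h2 : (fun q => F (i q)) =ᶠ[𝓝 p] fun _ => 0 := by
    filter_upwards [hF.isOpen_par.mem_nhds hp] with q hq using (hF.mem_locus q hq).2
  have h3 := h1.unique ((hasFDerivAt_const (0 : ℝ) p).congr_of_eventuallyEq h2)
  exact DFunLike.congr_fun h3 v

/-- The image of the derivative of `i` is 7-dimensional and lies in the kernel of `dF`, which is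
also 7-dimensional when `dF ≠ 0`. -/
theorem IsNondegParam.exists_fderiv_par_eq (hF : IsNondegParam F D S i) (hp : p ∈ S)
    (h0 : fderiv ℝ F (i p) ≠ 0) {X : Jet2} (hX : fderiv ℝ F (i p) X = 0) :
    ∃ v, fderiv ℝ i p v = X := by
  let f : Jet2 →ₗ[ℝ] ℝ := (fderiv ℝ F (i p) : Jet2 →L[ℝ] ℝ)
  let J : Par →ₗ[ℝ] Jet2 := (fderiv ℝ i p : Par →L[ℝ] Jet2)
  have hf : f ≠ 0 := fun h => h0 (ContinuousLinearMap.ext fun v => DFunLike.congr_fun h v)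
  have hle : LinearMap.range J ≤ LinearMap.ker f := by
    rintro _ ⟨v, rfl⟩
    exact hF.fderiv_fun_fderiv_par hp v
  have hJ : finrank ℝ (LinearMap.range J) = 7 := by
    rw [LinearMap.finrank_range_of_inj (hF.maxRank p hp)]
    simp
  have hk : finrank ℝ (LinearMap.ker f) + 1 = 8 := by
    rw [Dual.finrank_ker_add_one_of_ne_zero (f := f) hf]
    simp
  have heq := Submodule.eq_of_le_of_finrank_eq hle (by omega)
  have hm : X ∈ LinearMap.range J := heq ▸ (show X ∈ LinearMap.ker f from hX)
  exact hm

/-- A vanishing symbol would give `Δ = 0`. This provides `dF ≠ 0` and the denominator used in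
`exists_lift`. -/
theorem IsHyperbolic.symbol_sq_pos (hF : IsHyperbolic F D S i) (hp : p ∈ S) :
    0 < pr F (i p) ^ 2 + ps F (i p) ^ 2 + pt F (i p) ^ 2 := by
  have h := hF.discr_neg p hp
  unfold discr at h
  nlinarith [sq_nonneg (pr F (i p) + pt F (i p)), sq_nonneg (ps F (i p)),
    sq_nonneg (pr F (i p)), sq_nonneg (pt F (i p))]

theorem IsHyperbolic.exists_fderiv_par_eq_cons (hF : IsHyperbolic F D S i) (hp : p ∈ S)
    {X : Jet2} (hX : ∑ k, X k * pd k F (i p) = 0) : ∃ v, fderiv ℝ i p v = X := by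
  refine hF.toIsNondegParam.exists_fderiv_par_eq hp (fun h => ?_) (by rwa [fderiv_eq_sum_pd])
  have := hF.symbol_sq_pos hp
  simp [pd, h] at this

theorem IsHyperbolic.exists_vertical (hF : IsHyperbolic F D S i) (hp : p ∈ S) {r s t : ℝ}
    (h : r * pr F (i p) + s * ps F (i p) + t * pt F (i p) = 0) :
    ∃ v, fderiv ℝ i p v = ![0, 0, 0, 0, 0, r, s, t] :=
  hF.exists_fderiv_par_eq_cons hp (by simpa [Fin.sum_univ_eight, add_assoc] using h)

theorem IsHyperbolic.exists_lift (hF : IsHyperbolic F D S i) (hp : p ∈ S) (x y z a b : ℝ) :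
    ∃ v r s t, fderiv ℝ i p v = ![x, y, z, a, b, r, s, t] := by
  have h := hF.symbol_sq_pos hp
  set N := pr F (i p) ^ 2 + ps F (i p) ^ 2 + pt F (i p) ^ 2 with hN
  -- The vertical part is taken along `(F_r, F_s, F_t)`, with the multiple that cancels the
  -- contribution of the first five coordinates to `dF`.
  set m := -(x * pd 0 F (i p) + y * pd 1 F (i p) + z * pd 2 F (i p) + a * pd 3 F (i p) +
    b * pd 4 F (i p)) / N with hm
  obtain ⟨v, hv⟩ := hF.exists_fderiv_par_eq_cons hp
    (X := ![x, y, z, a, b, m * pr F (i p), m * ps F (i p), m * pt F (i p)]) (by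
      have hmN : m * N = -(x * pd 0 F (i p) + y * pd 1 F (i p) + z * pd 2 F (i p) +
        a * pd 3 F (i p) + b * pd 4 F (i p)) := by
        rw [hm]; field_simp
      rw [hN] at hmN
      rw [Fin.sum_univ_eight]
      show x * pd 0 F (i p) + y * pd 1 F (i p) + z * pd 2 F (i p) + a * pd 3 F (i p) +
        b * pd 4 F (i p) + m * pr F (i p) * pr F (i p) + m * ps F (i p) * ps F (i p) +
        m * pt F (i p) * pt F (i p) = 0
      linear_combination hmN)
  exact ⟨v, _, _, _, hv⟩

/-- The generators of the contact system, as a frame. -/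
def contactFrame (i : Par → Jet2) : Fin 3 → Par → Par →L[ℝ] ℝ :=
  ![pullback i theta1, pullback i theta2, pullback i theta3]

theorem contactSystem_eq_span (i : Par → Jet2) (p : Par) :
    contactSystem i p = Submodule.span ℝ (Set.range fun k => contactFrame i k p) := by
  unfold contactSystem
  congr 1
  ext α
  simp [contactFrame]
  tauto

theorem IsNondegParam.contDiffAt_contactFrame (hF : IsNondegParam F D S i) (hp : p ∈ S)
    (k : Fin 3) : ContDiffAt ℝ ∞ (contactFrame i k) p := by
  have hi := hF.contDiffAt_par hp
  fin_cases k
  · exact contDiffAt_pullback hi contDiff_theta1.contDiffAt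
  · exact contDiffAt_pullback hi contDiff_theta2.contDiffAt
  · exact contDiffAt_pullback hi contDiff_theta3.contDiffAt

theorem IsHyperbolic.exists_contact_dual (hF : IsHyperbolic F D S i) (hp : p ∈ S) :
    ∃ u : Fin 3 → Par, ∀ k j, contactFrame i k p (u j) = if j = k then 1 else 0 := by
  obtain ⟨u₁, r₁, s₁, t₁, h₁⟩ := hF.exists_lift hp 0 0 1 0 0
  obtain ⟨u₂, r₂, s₂, t₂, h₂⟩ := hF.exists_lift hp 0 0 0 1 0
  obtain ⟨u₃, r₃, s₃, t₃, h₃⟩ := hF.exists_lift hp 0 0 0 0 1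
  refine ⟨![u₁, u₂, u₃], fun k j => ?_⟩
  fin_cases k <;> fin_cases j <;>
    simp [contactFrame, pullback_theta1_apply, pullback_theta2_apply, pullback_theta3_apply,
      h₁, h₂, h₃]

theorem IsHyperbolic.linearIndependent_contactFrame (hF : IsHyperbolic F D S i) (hp : p ∈ S) :
    LinearIndependent ℝ fun k => contactFrame i k p := by
  obtain ⟨u, hu⟩ := hF.exists_contact_dual hp
  exact linearIndependent_of_dual hu

/-- The pullback under `i` of the coordinate differential number `k`. -/
def coordForm (i : Par → Jet2) (p : Par) (k : Fin 8) : Par →L[ℝ] ℝ :=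
  (dcoord k).comp (fderiv ℝ i p)

@[simp] theorem coordForm_apply (i : Par → Jet2) (p v : Par) (k : Fin 8) :
    coordForm i p k v = fderiv ℝ i p v k := rfl

/-- The form `(X, Y) ↦ dx ∧ X ∧ dy ∧ Y ∧ ω¹ ∧ ω² ∧ ω³` at `p`. -/
def contactCross (i : Par → Jet2) (p : Par) : (Par →L[ℝ] ℝ) →ₗ[ℝ] (Par →L[ℝ] ℝ) →ₗ[ℝ] ℝ :=
  crossForm rowDet (coordForm i p 0) (coordForm i p 1) (pullback i theta1 p) (pullback i theta2 p)
    (pullback i theta3 p)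

theorem form7_eq_contactCross (hi : ContDiffAt ℝ ∞ i p)
    (he : ∀ k, ContDiffAt ℝ ∞ (contactFrame i k) p)
    {φ ψ : Par → Par →L[ℝ] ℝ} {c c' : Fin 3 → Par → ℝ}
    (hc : ∀ k, ContDiffAt ℝ ∞ (c k) p) (hc' : ∀ k, ContDiffAt ℝ ∞ (c' k) p)
    (hφ : φ =ᶠ[𝓝 p] fun q => ∑ k, c k q • contactFrame i k q)
    (hψ : ψ =ᶠ[𝓝 p] fun q => ∑ k, c' k q • contactFrame i k q) :
    form7 i φ ψ p =
      contactCross i p (c 1 p • coordForm i p 5 + c 2 p • coordForm i p 6)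
        (c' 1 p • coordForm i p 6 + c' 2 p • coordForm i p 7) +
      contactCross i p (c' 1 p • coordForm i p 5 + c' 2 p • coordForm i p 6)
        (c 1 p • coordForm i p 6 + c 2 p • coordForm i p 7) := by
  -- The structure equations put `dφ` in the form `dx∧ζ₀ + dy∧ζ₁` plus terms containing some `ω`.
  -- Since `dω¹ = dx∧ω² + dy∧ω³`, the coefficient `c 0` enters only those last terms.
  have key : ∀ {φ : Par → Par →L[ℝ] ℝ} {c : Fin 3 → Par → ℝ}
      (_ : ∀ k, ContDiffAt ℝ ∞ (c k) p)
      (_ : φ =ᶠ[𝓝 p] fun q => ∑ k, c k q • contactFrame i k q) (u v : Par),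
      dForm φ p ![u, v] =
        coordForm i p 0 u * (c 1 p • coordForm i p 5 + c 2 p • coordForm i p 6) v -
        coordForm i p 0 v * (c 1 p • coordForm i p 5 + c 2 p • coordForm i p 6) u +
        (coordForm i p 1 u * (c 1 p • coordForm i p 6 + c 2 p • coordForm i p 7) v -
        coordForm i p 1 v * (c 1 p • coordForm i p 6 + c 2 p • coordForm i p 7) u) +
        (fderiv ℝ (c 0) p u * pullback i theta1 p v - fderiv ℝ (c 0) p v * pullback i theta1 p u) +
        ((fderiv ℝ (c 1) p + c 0 p • coordForm i p 0) u * pullback i theta2 p v -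
          (fderiv ℝ (c 1) p + c 0 p • coordForm i p 0) v * pullback i theta2 p u) +
        ((fderiv ℝ (c 2) p + c 0 p • coordForm i p 1) u * pullback i theta3 p v -
          (fderiv ℝ (c 2) p + c 0 p • coordForm i p 1) v * pullback i theta3 p u) := by
    intro φ c hc hφ u v
    have hd : ∀ k, DifferentiableAt ℝ (c k) p := fun k => (hc k).differentiableAt (by simp)
    have hd' : ∀ k, DifferentiableAt ℝ (contactFrame i k) p :=
      fun k => (he k).differentiableAt (by simp)
    rw [dForm_congr hφ (DifferentiableAt.fun_sum fun k _ => (hd k).smul (hd' k)),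
      dForm_sum_smul hd hd', Fin.sum_univ_three]
    simp only [contactFrame, Matrix.cons_val_zero, Matrix.cons_val_one, Matrix.cons_val,
      dForm_theta1 hi, dForm_theta2 hi, dForm_theta3 hi, pullback_theta1_apply,
      pullback_theta2_apply, pullback_theta3_apply, add_apply, smul_apply, coordForm_apply,
      smul_eq_mul]
    ring
  exact wedgeCoeff_eq_crossForm _ _ _ _ _ _ _ _ _ _ _ _ _ _ _ (key hc hφ) (key hc' hψ)

/-- Differentiating `F ∘ i = 0` and replacing `dz, dp, dq` by the contact forms expresses `F_r dr +
F_s ds + F_t dt` through `dx, dy, ω¹, ω², ω³`, all of which already occur in the wedge. -/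
theorem IsNondegParam.contactCross_symbol (hF : IsNondegParam F D S i) (hp : p ∈ S)
    (X : Par →L[ℝ] ℝ) :
    pr F (i p) * contactCross i p X (coordForm i p 5) +
      ps F (i p) * contactCross i p X (coordForm i p 6) +
      pt F (i p) * contactCross i p X (coordForm i p 7) = 0 := by
  have hrel : pr F (i p) • coordForm i p 5 + ps F (i p) • coordForm i p 6 +
      pt F (i p) • coordForm i p 7 =
      (-(pd 0 F (i p) + pd 2 F (i p) * i p 3 + pd 3 F (i p) * i p 5 + pd 4 F (i p) * i p 6)) •
        coordForm i p 0 +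
      (-(pd 1 F (i p) + pd 2 F (i p) * i p 4 + pd 3 F (i p) * i p 6 + pd 4 F (i p) * i p 7)) •
        coordForm i p 1 + (-pd 2 F (i p)) • pullback i theta1 p +
      (-pd 3 F (i p)) • pullback i theta2 p + (-pd 4 F (i p)) • pullback i theta3 p := by
    ext v
    have h := hF.fderiv_fun_fderiv_par hp v
    rw [fderiv_eq_sum_pd, Fin.sum_univ_eight] at h
    simp only [add_apply, smul_apply, coordForm_apply, smul_eq_mul, pullback_theta1_apply,
      pullback_theta2_apply, pullback_theta3_apply]
    linear_combination h
  have h := congrArg (contactCross i p X) hrel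
  simp only [map_add, map_smul, smul_eq_mul] at h
  rw [h]
  unfold contactCross
  rw [crossForm_right_eq_zero, crossForm_right_eq_zero, crossForm_right_eq_zero,
    crossForm_right_eq_zero, crossForm_right_eq_zero] <;> simp

/-- Here `k, l, m` exhaust the fibre coordinates. A vector killed by all seven covectors can have
only its `m`-th image coordinate nonzero; `dF` then kills that one too, and maximal rank makes the
vector zero. -/
theorem IsNondegParam.contactCross_ne_zero (hF : IsNondegParam F D S i) (hp : p ∈ S)
    {k l m : Fin 8} (hm : pd m F (i p) ≠ 0)
    (hklm : ∀ j : Fin 8, 5 ≤ j → j = k ∨ j = l ∨ j = m) :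
    contactCross i p (coordForm i p k) (coordForm i p l) ≠ 0 := by
  refine rowDet_ne_zero fun v hv => ?_
  have h0 : fderiv ℝ i p v 0 = 0 := hv 0
  have hk : fderiv ℝ i p v k = 0 := hv 1
  have h1 : fderiv ℝ i p v 1 = 0 := hv 2
  have hl : fderiv ℝ i p v l = 0 := hv 3
  have h2 : pullback i theta1 p v = 0 := hv 4
  have h3 : pullback i theta2 p v = 0 := hv 5
  have h4 : pullback i theta3 p v = 0 := hv 6
  rw [pullback_theta1_apply, h0, h1, mul_zero, mul_zero, sub_zero, sub_zero] at h2
  rw [pullback_theta2_apply, h0, h1, mul_zero, mul_zero, sub_zero, sub_zero] at h3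
  rw [pullback_theta3_apply, h0, h1, mul_zero, mul_zero, sub_zero, sub_zero] at h4
  have hj : ∀ j, j ≠ m → fderiv ℝ i p v j = 0 := by
    intro j hjm
    by_cases h5 : 5 ≤ j
    · rcases hklm j h5 with rfl | rfl | rfl
      · exact hk
      · exact hl
      · exact absurd rfl hjm
    · fin_cases j
      · exact h0
      · exact h1
      · exact h2
      · exact h3
      · exact h4
      all_goals exact absurd (by decide) h5
  have hs := hF.fderiv_fun_fderiv_par hp v
  rw [fderiv_eq_sum_pd, Finset.sum_eq_single m (fun j _ h => by rw [hj j h, zero_mul])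
    (by simp)] at hs
  refine hF.maxRank p hp ?_
  rw [map_zero]
  ext j
  by_cases h : j = m
  · rw [h]; exact (mul_eq_zero.1 hs).resolve_right hm
  · exact hj j h

/-- The form `⟨·,·⟩₇` on the contact system is a nonzero multiple of the polarization of
`F_t a² - F_s a b + F_r b²`. -/
theorem IsHyperbolic.exists_form7_eq (hF : IsHyperbolic F D S i) (hp : p ∈ S) :
    ∃ m : ℝ, m ≠ 0 ∧ ∀ {φ ψ : Par → Par →L[ℝ] ℝ} {c c' : Fin 3 → Par → ℝ},
      (∀ k, ContDiffAt ℝ ∞ (c k) p) → (∀ k, ContDiffAt ℝ ∞ (c' k) p) →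
      (φ =ᶠ[𝓝 p] fun q => ∑ k, c k q • contactFrame i k q) →
      (ψ =ᶠ[𝓝 p] fun q => ∑ k, c' k q • contactFrame i k q) →
      form7 i φ ψ p = m * (2 * pt F (i p) * c 1 p * c' 1 p -
        ps F (i p) * (c 1 p * c' 2 p + c' 1 p * c 2 p) + 2 * pr F (i p) * c 2 p * c' 2 p) := by
  set r := pr F (i p) with hr
  set s := ps F (i p) with hs
  set t := pt F (i p) with ht
  have hW := hF.toIsNondegParam.contactCross_symbol hp
  rw [← hr, ← hs, ← ht] at hW
  have hself : ∀ X, contactCross i p X X = 0 := fun X => crossForm_self _ _ _ _ _ _ _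
  have hneg : ∀ X Y, contactCross i p Y X = -contactCross i p X Y :=
    fun X Y => crossForm_neg_swap _ _ _ _ _ _ _ _
  have h5 := hW (coordForm i p 5)
  have h6 := hW (coordForm i p 6)
  have h7 := hW (coordForm i p 7)
  rw [hself] at h5 h6 h7
  rw [hneg (coordForm i p 5) (coordForm i p 6)] at h6
  rw [hneg (coordForm i p 5) (coordForm i p 7), hneg (coordForm i p 6) (coordForm i p 7)] at h7
  set A := contactCross i p (coordForm i p 5) (coordForm i p 6)
  set B := contactCross i p (coordForm i p 5) (coordForm i p 7)
  set C := contactCross i p (coordForm i p 6) (coordForm i p 7)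
  -- The three relations say that `(A, B, C)` is proportional to `(t, -s, r)`. The factor is read
  -- off from `C` if `r ≠ 0`, and otherwise from `B`, since hyperbolicity then forces `s ≠ 0`.
  have hval : ∃ m : ℝ, m ≠ 0 ∧ A = m * t ∧ B = -(m * s) ∧ C = m * r := by
    by_cases hr0 : r = 0
    · have hs0 : s ≠ 0 := by
        intro h
        have := hF.discr_neg p hp
        rw [discr, ← hr, ← hs, hr0, h] at this
        norm_num at this
      have hB : B ≠ 0 := hF.toIsNondegParam.contactCross_ne_zero hp (m := 6) hs0 (by decide)
      refine ⟨-B / s, div_ne_zero (neg_ne_zero.2 hB) hs0, ?_, ?_, ?_⟩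
      · field_simp; linear_combination h5
      · field_simp
      · field_simp; linear_combination -h7
    · have hC : C ≠ 0 := hF.toIsNondegParam.contactCross_ne_zero hp (m := 5) hr0 (by decide)
      refine ⟨C / r, div_ne_zero hC hr0, ?_, ?_, ?_⟩
      · field_simp; linear_combination -h6
      · field_simp; linear_combination -h7
      · field_simp
  obtain ⟨m, hm, hA, hB, hC⟩ := hval
  refine ⟨m, hm, fun {φ ψ c c'} hc hc' hφ hψ => ?_⟩
  rw [form7_eq_contactCross (hF.contDiffAt_par hp) (hF.contDiffAt_contactFrame hp) hc hc' hφ hψ]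
  simp only [map_add, map_smul, LinearMap.add_apply, LinearMap.smul_apply, smul_eq_mul, hself]
  linear_combination 2 * c 1 p * c' 1 p * hA + (c 1 p * c' 2 p + c' 1 p * c 2 p) * hB +
    2 * c 2 p * c' 2 p * hC

end

/-! ### Rank two subsystems `⟨ω¹, a ω² + b ω³⟩`. -/

section

/-- The 1-forms `ω¹` and `a ω² + b ω³`. -/
def charFrame (i : Par → Jet2) (a b : Par → ℝ) : Fin 2 → Par → Par →L[ℝ] ℝ :=
  ![pullback i theta1, fun q => a q • pullback i theta2 q + b q • pullback i theta3 q]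

/-- The Pfaffian system generated by `ω¹` and `a ω² + b ω³`. -/
def charSystem (i : Par → Jet2) (a b : Par → ℝ) (p : Par) : Submodule ℝ (Par →L[ℝ] ℝ) :=
  Submodule.span ℝ (Set.range fun k => charFrame i a b k p)

variable {F : Jet2 → ℝ} {D : Set Jet2} {S : Set Par} {i : Par → Jet2} {p : Par} {a b : Par → ℝ}

theorem sq_add_sq_pos {x y : ℝ} (h : x ≠ 0 ∨ y ≠ 0) : 0 < x ^ 2 + y ^ 2 := by
  rcases h with h | h <;> positivity

theorem mem_charSystem_iff {α : Par →L[ℝ] ℝ} : α ∈ charSystem i a b p ↔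
    ∃ k l : ℝ, α = k • pullback i theta1 p +
      l • (a p • pullback i theta2 p + b p • pullback i theta3 p) := by
  unfold charSystem
  rw [Submodule.mem_span_range_iff_exists_fun]
  constructor
  · rintro ⟨c, rfl⟩
    exact ⟨c 0, c 1, by rw [Fin.sum_univ_two]; rfl⟩
  · rintro ⟨k, l, rfl⟩
    exact ⟨![k, l], by rw [Fin.sum_univ_two]; rfl⟩

/-- Membership is proportionality of `(c 1, c 2)` to `(a, b)`, expressed by a determinant; the `ω¹`
coefficient is free. The determinant makes non-membership visibly an open condition. -/
theorem IsHyperbolic.sum_mem_charSystem_iff (hF : IsHyperbolic F D S i) (hp : p ∈ S)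
    (hab : a p ≠ 0 ∨ b p ≠ 0) (c : Fin 3 → ℝ) :
    ∑ k, c k • contactFrame i k p ∈ charSystem i a b p ↔ b p * c 1 = a p * c 2 := by
  rw [mem_charSystem_iff]
  constructor
  · rintro ⟨k, l, h⟩
    have h1 := (Fintype.linearIndependent_iff.1 (hF.linearIndependent_contactFrame hp))
      (c - ![k, l * a p, l * b p]) (by
        simp only [Pi.sub_apply, sub_smul, Finset.sum_sub_distrib, h]
        rw [Fin.sum_univ_three]
        simp [contactFrame, mul_smul, smul_add, add_assoc])
    have h2 := h1 1
    have h3 := h1 2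
    simp only [Pi.sub_apply, Matrix.cons_val_one, Matrix.cons_val, Matrix.cons_val_zero] at h2 h3
    linear_combination b p * h2 - a p * h3
  · intro h
    have h0 := (sq_add_sq_pos hab).ne'
    refine ⟨c 0, (a p * c 1 + b p * c 2) / (a p ^ 2 + b p ^ 2), ?_⟩
    have h1 : (a p * c 1 + b p * c 2) / (a p ^ 2 + b p ^ 2) * a p = c 1 := by
      field_simp; linear_combination -b p * h
    have h2 : (a p * c 1 + b p * c 2) / (a p ^ 2 + b p ^ 2) * b p = c 2 := by
      field_simp; linear_combination a p * h
    rw [smul_add, smul_smul, smul_smul, h1, h2, Fin.sum_univ_three]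
    simp [contactFrame, add_assoc]

theorem IsHyperbolic.exists_char_dual (hF : IsHyperbolic F D S i) (hp : p ∈ S)
    (hab : a p ≠ 0 ∨ b p ≠ 0) :
    ∃ u : Fin 2 → Par, ∀ k j, charFrame i a b k p (u j) = if j = k then 1 else 0 := by
  have h0 := (sq_add_sq_pos hab).ne'
  obtain ⟨u₁, r₁, s₁, t₁, h₁⟩ := hF.exists_lift hp 0 0 1 0 0
  obtain ⟨u₂, r₂, s₂, t₂, h₂⟩ := hF.exists_lift hp 0 0 0 (a p / (a p ^ 2 + b p ^ 2))
    (b p / (a p ^ 2 + b p ^ 2))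
  refine ⟨![u₁, u₂], fun k j => ?_⟩
  fin_cases k <;> fin_cases j <;>
    simp [charFrame, pullback_theta1_apply, pullback_theta2_apply, pullback_theta3_apply, h₁, h₂]
  field_simp

theorem IsHyperbolic.linearIndependent_charFrame (hF : IsHyperbolic F D S i) (hp : p ∈ S)
    (hab : a p ≠ 0 ∨ b p ≠ 0) : LinearIndependent ℝ fun k => charFrame i a b k p := by
  obtain ⟨u, hu⟩ := hF.exists_char_dual hp hab
  exact linearIndependent_of_dual hu

theorem IsHyperbolic.finrank_charSystem (hF : IsHyperbolic F D S i) (hp : p ∈ S)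
    (hab : a p ≠ 0 ∨ b p ≠ 0) : finrank ℝ (charSystem i a b p) = 2 := by
  unfold charSystem
  rw [finrank_span_eq_card (hF.linearIndependent_charFrame hp hab)]
  simp

theorem IsNondegParam.contDiffAt_charFrame (hF : IsNondegParam F D S i) (hp : p ∈ S)
    (ha : ContDiffAt ℝ ∞ a p) (hb : ContDiffAt ℝ ∞ b p) (k : Fin 2) :
    ContDiffAt ℝ ∞ (charFrame i a b k) p := by
  have hc := hF.contDiffAt_contactFrame hp
  fin_cases k
  · exact hc 0
  · exact (ha.smul (hc 1)).add (hb.smul (hc 2))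

theorem charSystem_le_contactSystem (i : Par → Jet2) (a b : Par → ℝ) (p : Par) :
    charSystem i a b p ≤ contactSystem i p := by
  intro α hα
  obtain ⟨k, l, rfl⟩ := mem_charSystem_iff.1 hα
  have h : ∀ β ∈ ({pullback i theta1 p, pullback i theta2 p, pullback i theta3 p} :
      Set (Par →L[ℝ] ℝ)), β ∈ contactSystem i p := fun β hβ => Submodule.subset_span hβ
  exact add_mem (Submodule.smul_mem _ _ (h _ (by simp))) (Submodule.smul_mem _ _
    (add_mem (Submodule.smul_mem _ _ (h _ (by simp))) (Submodule.smul_mem _ _ (h _ (by simp)))))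

theorem IsSection.contDiffAt {M : Par → Submodule ℝ (Par →L[ℝ] ℝ)} {V : Set Par}
    {φ : Par → Par →L[ℝ] ℝ} (h : IsSection M V φ) (hV : IsOpen V) (hp : p ∈ V) :
    ContDiffAt ℝ ∞ φ p :=
  h.1.contDiffAt (hV.mem_nhds hp)

theorem IsSection.eventually_mem {M : Par → Submodule ℝ (Par →L[ℝ] ℝ)} {V : Set Par}
    {φ : Par → Par →L[ℝ] ℝ} (h : IsSection M V φ) (hV : IsOpen V) (hp : p ∈ V) :
    ∀ᶠ q in 𝓝 p, φ q ∈ M q := by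
  filter_upwards [hV.mem_nhds hp] with q hq using h.2 q hq

theorem IsHyperbolic.exists_contact_coeffs (hF : IsHyperbolic F D S i) (hp : p ∈ S)
    {φ : Par → Par →L[ℝ] ℝ} (hφ : ContDiffAt ℝ ∞ φ p)
    (hm : ∀ᶠ q in 𝓝 p, φ q ∈ contactSystem i q) :
    ∃ c : Fin 3 → Par → ℝ, (∀ k, ContDiffAt ℝ ∞ (c k) p) ∧
      ∀ᶠ q in 𝓝 p, φ q = ∑ k, c k q • contactFrame i k q := by
  obtain ⟨u, hu⟩ := hF.exists_contact_dual hp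
  simp only [contactSystem_eq_span] at hm
  exact exists_smooth_coeffs (hF.contDiffAt_contactFrame hp) hφ u hu hm

/-- The `ω², ω³` coefficients of any two sections at a point are multiples of `(a, b)`, so the
polarized form is a multiple of its value at `(a, b)`, which is zero by `hq`. -/
theorem IsHyperbolic.isIsotropic_charSystem (hF : IsHyperbolic F D S i)
    (ha : ∀ p ∈ S, ContDiffAt ℝ ∞ a p) (hb : ∀ p ∈ S, ContDiffAt ℝ ∞ b p)
    (hab : ∀ p ∈ S, a p ≠ 0 ∨ b p ≠ 0)
    (hq : ∀ p ∈ S, pt F (i p) * a p ^ 2 - ps F (i p) * a p * b p + pr F (i p) * b p ^ 2 = 0) :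
    IsIsotropic S i (charSystem i a b) where
  pfaffian p hp := ⟨S, hF.isOpen_par, hp, subset_rfl, charFrame i a b,
    fun k q hq => (hF.contDiffAt_charFrame hq (ha q hq) (hb q hq) k).contDiffWithinAt,
    fun q hq => ⟨hF.linearIndependent_charFrame hq (hab q hq), rfl⟩⟩
  le_contact p _ := charSystem_le_contactSystem i a b p
  isotropic V hV hVS φ ψ hφ hψ p hp := by
    have hpS := hVS hp
    obtain ⟨m, -, hm⟩ := hF.exists_form7_eq hpS
    have key : ∀ {φ}, IsSection (charSystem i a b) V φ → ∃ c : Fin 3 → Par → ℝ,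
        (∀ k, ContDiffAt ℝ ∞ (c k) p) ∧ (φ =ᶠ[𝓝 p] fun q => ∑ k, c k q • contactFrame i k q) ∧
        b p * c 1 p = a p * c 2 p := by
      intro φ hφ
      obtain ⟨c, hc, hc'⟩ := hF.exists_contact_coeffs hpS (hφ.contDiffAt hV hp)
        ((hφ.eventually_mem hV hp).mono fun q hq => charSystem_le_contactSystem i a b q hq)
      refine ⟨c, hc, hc', ?_⟩
      rw [← hF.sum_mem_charSystem_iff hpS (hab p hpS) fun k => c k p, ← hc'.self_of_nhds]
      exact hφ.2 p hp
    obtain ⟨c, hc, hcφ, hcab⟩ := key hφ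
    obtain ⟨c', hc', hcψ, hcab'⟩ := key hψ
    rw [hm hc hc' hcφ hcψ]
    have hquad := hq p hpS
    have h0 := (sq_add_sq_pos (hab p hpS)).ne'
    have hk : ∀ c : Fin 3 → Par → ℝ, b p * c 1 p = a p * c 2 p →
        ∃ l, c 1 p = l * a p ∧ c 2 p = l * b p := by
      intro c h
      refine ⟨(a p * c 1 p + b p * c 2 p) / (a p ^ 2 + b p ^ 2), ?_, ?_⟩
      · field_simp; linear_combination b p * h
      · field_simp; linear_combination -a p * h
    obtain ⟨l, h1, h2⟩ := hk c hcab
    obtain ⟨l', h1', h2'⟩ := hk c' hcab'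
    rw [h1, h2, h1', h2']
    linear_combination 2 * m * l * l' * hquad

theorem finrank_eq_of_isPfaffian {M : Par → Submodule ℝ (Par →L[ℝ] ℝ)} {n : ℕ}
    (hM : IsPfaffian S M n) (hp : p ∈ S) : finrank ℝ (M p) = n := by
  obtain ⟨V, -, hpV, -, η, -, h⟩ := hM p hp
  rw [(h p hpV).2, finrank_span_eq_card (h p hpV).1]
  simp

/-- A system that differs at a point from `⟨ω¹, a ω² + b ω³⟩` differs from it nearby. -/
theorem IsHyperbolic.eventually_ne_charSystem (hF : IsHyperbolic F D S i) (hp : p ∈ S)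
    {M : Par → Submodule ℝ (Par →L[ℝ] ℝ)} (hM : IsIsotropic S i M)
    (ha : ContinuousAt a p) (hb : ContinuousAt b p) (hab : ∀ p ∈ S, a p ≠ 0 ∨ b p ≠ 0)
    (hne : M p ≠ charSystem i a b p) : ∀ᶠ q in 𝓝 p, M q ≠ charSystem i a b q := by
  obtain ⟨V, hV, hpV, hVS, η, hη, h⟩ := hM.pfaffian p hp
  have hsec : ∀ j, IsSection M V (η j) := fun j =>
    ⟨hη j, fun q hq => (h q hq).2 ▸ Submodule.subset_span ⟨j, rfl⟩⟩
  -- By equality of ranks, some frame element lies outside at `p`; its nonzero determinant `b c₁ - a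
  -- c₂` stays nonzero nearby.
  obtain ⟨j, hj⟩ : ∃ j, η j p ∉ charSystem i a b p := by
    by_contra! hall
    refine hne (Submodule.eq_of_le_of_finrank_eq ?_ ?_)
    · rw [(h p hpV).2, Submodule.span_le]
      rintro _ ⟨j, rfl⟩
      exact hall j
    · rw [finrank_eq_of_isPfaffian hM.pfaffian hp, hF.finrank_charSystem hp (hab p hp)]
  obtain ⟨c, hc, hc'⟩ := hF.exists_contact_coeffs hp ((hsec j).contDiffAt hV hpV)
    (by filter_upwards [hV.mem_nhds hpV] with q hq using hM.le_contact q (hVS hq) ((hsec j).2 q hq))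
  rw [hc'.self_of_nhds, hF.sum_mem_charSystem_iff hp (hab p hp) fun k => c k p] at hj
  have hne : ∀ᶠ q in 𝓝 p, b q * c 1 q ≠ a q * c 2 q :=
    ((((hb.mul (hc 1).continuousAt).sub (ha.mul (hc 2).continuousAt)).eventually_ne
      (sub_ne_zero.2 hj))).mono fun q => sub_ne_zero.1
  filter_upwards [hne, hc', hV.mem_nhds hpV] with q h1 h2 h3 h4
  refine h1 ((hF.sum_mem_charSystem_iff (hVS h3) (hab q (hVS h3)) fun k => c k q).1 ?_)
  rw [← h2, ← h4]
  exact (hsec j).2 q h3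

end

/-! ### Cauchy characteristics and the class. -/

section

variable {F : Jet2 → ℝ} {D : Set Jet2} {S : Set Par} {i : Par → Jet2} {p : Par} {a b : Par → ℝ}
  {M : Par → Submodule ℝ (Par →L[ℝ] ℝ)}

theorem charFrame_mem_charSystem (k : Fin 2) : charFrame i a b k p ∈ charSystem i a b p :=
  Submodule.subset_span ⟨k, rfl⟩

/-- The Cauchy characteristic space can be computed on a local frame. -/
theorem IsHyperbolic.mem_cauchyChar_iff (hF : IsHyperbolic F D S i) (hp : p ∈ S)
    (ha : ∀ q ∈ S, ContDiffAt ℝ ∞ a q) (hb : ∀ q ∈ S, ContDiffAt ℝ ∞ b q)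
    (hab : a p ≠ 0 ∨ b p ≠ 0) (hM : M =ᶠ[𝓝 p] charSystem i a b) (v : Par) :
    v ∈ cauchyChar S M p ↔ (∀ k, charFrame i a b k p v = 0) ∧
      ∀ k, ∃ β ∈ charSystem i a b p, ∀ w, dForm (charFrame i a b k) p ![v, w] = β w := by
  have hMp : M p = charSystem i a b p := hM.self_of_nhds
  have hsm : ∀ q ∈ S, ∀ k, ContDiffAt ℝ ∞ (charFrame i a b k) q := fun q hq k =>
    hF.contDiffAt_charFrame hq (ha q hq) (hb q hq) k
  constructor
  · rintro ⟨h1, h2⟩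
    rw [hMp] at h1 h2
    refine ⟨fun k => h1 _ (charFrame_mem_charSystem k), fun k => ?_⟩
    obtain ⟨V, hV, hVo, hpV⟩ := eventually_nhds_iff.1 (hM.and (hF.isOpen_par.mem_nhds hp))
    exact h2 V hVo hpV (fun q hq => (hV q hq).2) _
      ⟨fun q hq => (hsm q (hV q hq).2 k).contDiffWithinAt, fun q hq => by
        rw [(hV q hq).1]; exact charFrame_mem_charSystem k⟩
  · rintro ⟨h1, h2⟩
    refine ⟨fun α hα => ?_, fun V hV hpV hVS η hη => ?_⟩
    · rw [hMp, charSystem, Submodule.mem_span_range_iff_exists_fun] at hα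
      obtain ⟨c, rfl⟩ := hα
      simp [h1]
    · rw [hMp]
      obtain ⟨u, hu⟩ := hF.exists_char_dual hp hab
      have hmem : ∀ᶠ q in 𝓝 p, η q ∈ charSystem i a b q := by
        filter_upwards [hη.eventually_mem hV hpV, hM] with q hq hq' using hq' ▸ hq
      obtain ⟨c, hc, hc'⟩ := exists_smooth_coeffs (hsm p hp) (hη.contDiffAt hV hpV) u hu hmem
      choose β hβ hβ' using h2
      have hd : ∀ k, DifferentiableAt ℝ (c k) p := fun k => (hc k).differentiableAt (by simp)
      have hd' : ∀ k, DifferentiableAt ℝ (charFrame i a b k) p :=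
        fun k => (hsm p hp k).differentiableAt (by simp)
      -- Contracting the Leibniz formula with `v` leaves exactly these terms, since `v` annihilates
      -- the frame.
      refine ⟨∑ k, (c k p • β k + fderiv ℝ (c k) p v • charFrame i a b k p),
        sum_mem fun k _ => add_mem (Submodule.smul_mem _ _ (hβ k))
          (Submodule.smul_mem _ _ (charFrame_mem_charSystem k)), fun w => ?_⟩
      rw [dForm_congr hc' (DifferentiableAt.fun_sum fun k _ => (hd k).smul (hd' k)),
        dForm_sum_smul hd hd']
      simp [h1, hβ']

theorem dForm_charFrame_zero (hi : ContDiffAt ℝ ∞ i p) (u v : Par) :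
    dForm (charFrame i a b 0) p ![u, v] =
      fderiv ℝ i p v 3 * fderiv ℝ i p u 0 + fderiv ℝ i p v 4 * fderiv ℝ i p u 1 -
      fderiv ℝ i p u 3 * fderiv ℝ i p v 0 - fderiv ℝ i p u 4 * fderiv ℝ i p v 1 :=
  dForm_theta1 hi u v

theorem IsHyperbolic.dForm_charFrame_one (hF : IsHyperbolic F D S i) (hp : p ∈ S)
    (ha : ContDiffAt ℝ ∞ a p) (hb : ContDiffAt ℝ ∞ b p) (u v : Par) :
    dForm (charFrame i a b 1) p ![u, v] =
      a p * (fderiv ℝ i p v 5 * fderiv ℝ i p u 0 + fderiv ℝ i p v 6 * fderiv ℝ i p u 1 -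
        fderiv ℝ i p u 5 * fderiv ℝ i p v 0 - fderiv ℝ i p u 6 * fderiv ℝ i p v 1) +
      b p * (fderiv ℝ i p v 6 * fderiv ℝ i p u 0 + fderiv ℝ i p v 7 * fderiv ℝ i p u 1 -
        fderiv ℝ i p u 6 * fderiv ℝ i p v 0 - fderiv ℝ i p u 7 * fderiv ℝ i p v 1) +
      (fderiv ℝ a p u * pullback i theta2 p v - fderiv ℝ a p v * pullback i theta2 p u) +
      (fderiv ℝ b p u * pullback i theta3 p v - fderiv ℝ b p v * pullback i theta3 p u) := by
  have hi := hF.contDiffAt_par hp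
  have hs := dForm_sum_smul (n := 2) (c := ![a, b])
    (e := ![pullback i theta2, pullback i theta3]) (p := p)
    (by
      intro k
      fin_cases k
      · exact ha.differentiableAt (by simp)
      · exact hb.differentiableAt (by simp))
    (by
      intro k
      fin_cases k
      · exact (hF.contDiffAt_contactFrame hp 1).differentiableAt (by simp)
      · exact (hF.contDiffAt_contactFrame hp 2).differentiableAt (by simp)) u v
  simp only [Fin.sum_univ_two, Matrix.cons_val_zero, Matrix.cons_val_one] at hs
  refine (show dForm (charFrame i a b 1) p ![u, v] = _ from hs).trans ?_
  rw [dForm_theta2 hi, dForm_theta3 hi]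
  ring

/-- If `l ≠ 0`, the functional `(x², 2xy, y²)` vanishes on the plane orthogonal to `(r, s, t)`, so
the two triples are proportional; but `(x², 2xy, y²)` has zero discriminant. -/
theorem eq_zero_of_isotropic_direction {r s t x y l : ℝ} (hd : r * t - (1 / 4) * s ^ 2 < 0)
    (hxy : x ≠ 0 ∨ y ≠ 0)
    (h : ∀ u v w, u * r + v * s + w * t = 0 → l * (x ^ 2 * u + 2 * x * y * v + y ^ 2 * w) = 0) :
    l = 0 := by
  by_contra hl
  have h1 := (mul_eq_zero.1 (h s (-r) 0 (by ring))).resolve_left hl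
  have h2 := (mul_eq_zero.1 (h 0 t (-s) (by ring))).resolve_left hl
  have h3 := (mul_eq_zero.1 (h t 0 (-r) (by ring))).resolve_left hl
  rcases hxy with hx | hy
  · have h4 : x * s = 2 * y * r := mul_left_cancel₀ hx (by linear_combination h1)
    have h5 : x ^ 2 * (r * t - (1 / 4) * s ^ 2) = 0 := by
      linear_combination r * h3 - (1 / 4) * (x * s + 2 * y * r) * h4
    exact hd.ne ((mul_eq_zero.1 h5).resolve_left (pow_ne_zero 2 hx))
  · have h4 : y * s = 2 * x * t := mul_left_cancel₀ hy (by linear_combination -h2)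
    have h5 : y ^ 2 * (r * t - (1 / 4) * s ^ 2) = 0 := by
      linear_combination -t * h3 - (1 / 4) * (y * s + 2 * x * t) * h4
    exact hd.ne ((mul_eq_zero.1 h5).resolve_left (pow_ne_zero 2 hy))

/-- Cauchy characteristic vectors of `⟨ω¹, a ω² + b ω³⟩` are vertical multiples of
`(b², -a b, a²)`. -/
theorem IsHyperbolic.cauchyChar_subset (hF : IsHyperbolic F D S i) (hp : p ∈ S)
    (ha : ∀ q ∈ S, ContDiffAt ℝ ∞ a q) (hb : ∀ q ∈ S, ContDiffAt ℝ ∞ b q)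
    (hab : a p ≠ 0 ∨ b p ≠ 0) (hM : M =ᶠ[𝓝 p] charSystem i a b)
    {v : Par} (hv : v ∈ cauchyChar S M p) :
    (∃ m : ℝ, fderiv ℝ i p v = m • ![0, 0, 0, 0, 0, b p ^ 2, -(a p * b p), a p ^ 2]) ∧
      a p * fderiv ℝ b p v = b p * fderiv ℝ a p v := by
  obtain ⟨h1, h2⟩ := (hF.mem_cauchyChar_iff hp ha hb hab hM v).1 hv
  have hi := hF.contDiffAt_par hp
  have hω1 : pullback i theta1 p v = 0 := h1 0
  have hpos := (sq_add_sq_pos hab).ne'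
  set X := fderiv ℝ i p v with hX
  obtain ⟨β, hβ, hβ'⟩ := h2 0
  obtain ⟨γ, hγ, hγ'⟩ := h2 1
  obtain ⟨k, l, rfl⟩ := mem_charSystem_iff.1 hβ
  obtain ⟨k', l', rfl⟩ := mem_charSystem_iff.1 hγ
  simp only [dForm_charFrame_zero hi, hF.dForm_charFrame_one hp (ha p hp) (hb p hp), add_apply,
    smul_apply, smul_eq_mul, pullback_theta1_apply, pullback_theta2_apply, pullback_theta3_apply,
    ← hX] at hβ' hγ' hω1
  -- Up to vertical parts, `u₀, u₁` are the total derivatives in `x` and `y`, killed by all contact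
  -- forms, while `u₃, u₄` lift `∂_p, ∂_q` and are dual to `ω², ω³`.
  obtain ⟨u₀, r₀, s₀, t₀, hu₀⟩ := hF.exists_lift hp 1 0 (i p 3) (i p 5) (i p 6)
  obtain ⟨u₁, r₁, s₁, t₁, hu₁⟩ := hF.exists_lift hp 0 1 (i p 4) (i p 6) (i p 7)
  obtain ⟨u₃, r₃, s₃, t₃, hu₃⟩ := hF.exists_lift hp 0 0 0 1 0
  obtain ⟨u₄, r₄, s₄, t₄, hu₄⟩ := hF.exists_lift hp 0 0 0 0 1
  have e0 := hβ' u₀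
  have e1 := hβ' u₁
  have e3 := hβ' u₃
  have e4 := hβ' u₄
  simp [hu₀] at e0
  simp [hu₁] at e1
  simp [hu₃] at e3
  simp [hu₄] at e4
  -- So far `dx(v) = l a`, `dy(v) = l b` and `ω²(v) = ω³(v) = 0`. Testing the second generator on
  -- vertical tangent vectors `(u, w, z)` gives `l (a² u + 2 a b w + b² z) = 0`.
  have hl : l = 0 := by
    refine eq_zero_of_isotropic_direction (hF.discr_neg p hp) hab fun u w z h => ?_
    obtain ⟨x, hx⟩ := hF.exists_vertical hp h
    have e := hγ' x
    simp [hx] at e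
    rw [e3, e4] at e
    have e0' : X 3 - i p 5 * X 0 - i p 6 * X 1 = 0 := by linarith
    have e1' : X 4 - i p 6 * X 0 - i p 7 * X 1 = 0 := by linarith
    rw [e3, e4] at e0' e1'
    rw [e0', e1'] at e
    linear_combination e
  have hX0 : X 0 = 0 := by rw [e3, hl, zero_mul]
  have hX1 : X 1 = 0 := by rw [e4, hl, zero_mul]
  rw [hX0, hX1] at e0 e1 hω1
  have hX2 : X 2 = 0 := by linarith
  have hX3 : X 3 = 0 := by linarith
  have hX4 : X 4 = 0 := by linarith
  simp only [hX0, hX1, hX3, hX4] at hγ'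
  have f0 := hγ' u₀
  have f1 := hγ' u₁
  have f3 := hγ' u₃
  have f4 := hγ' u₄
  simp [hu₀] at f0
  simp [hu₁] at f1
  simp [hu₃] at f3
  simp [hu₄] at f4
  have g0 : a p * X 5 + b p * X 6 = 0 := by linarith
  have g1 : a p * X 6 + b p * X 7 = 0 := by linarith
  -- The kernel of `g0, g1` is spanned by `(b², -a b, a²)`, and adding the outer entries recovers
  -- the multiple. By `f3, f4`, `(da(v), db(v))` equals `l' (a, b)`.
  refine ⟨⟨(X 5 + X 7) / (a p ^ 2 + b p ^ 2), ?_⟩, by rw [f3, f4]; ring⟩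
  ext j
  fin_cases j
  · simpa using hX0
  · simpa using hX1
  · simpa using hX2
  · simpa using hX3
  · simpa using hX4
  · simp
    field_simp
    linear_combination a p * g0 - b p * g1
  · simp
    field_simp
    linear_combination b p * g0 + a p * g1
  · simp
    field_simp
    linear_combination b p * g1 - a p * g0

theorem IsHyperbolic.mem_cauchyChar_of_vertical (hF : IsHyperbolic F D S i) (hp : p ∈ S)
    (ha : ∀ q ∈ S, ContDiffAt ℝ ∞ a q) (hb : ∀ q ∈ S, ContDiffAt ℝ ∞ b q)
    (hab : a p ≠ 0 ∨ b p ≠ 0) (hM : M =ᶠ[𝓝 p] charSystem i a b)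
    {v : Par} (hv : fderiv ℝ i p v = ![0, 0, 0, 0, 0, b p ^ 2, -(a p * b p), a p ^ 2])
    (hdv : a p * fderiv ℝ b p v = b p * fderiv ℝ a p v) : v ∈ cauchyChar S M p := by
  have hi := hF.contDiffAt_par hp
  have hpos := (sq_add_sq_pos hab).ne'
  have hω : pullback i theta1 p v = 0 ∧ pullback i theta2 p v = 0 ∧ pullback i theta3 p v = 0 := by
    simp [pullback_theta1_apply, pullback_theta2_apply, pullback_theta3_apply, hv]
  rw [hF.mem_cauchyChar_iff hp ha hb hab hM]
  refine ⟨fun k => ?_, fun k => ?_⟩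
  · fin_cases k
    · exact hω.1
    · simp [charFrame, hω]
  · fin_cases k
    · refine ⟨0, zero_mem _, fun w => ?_⟩
      refine (dForm_charFrame_zero hi v w).trans ?_
      simp [hv]
    -- The contraction is `da(v) ω² + db(v) ω³`; by `hdv` its coefficients are a multiple of `(a,
    -- b)`, and the factor is found by orthogonal projection.
    · refine ⟨_, mem_charSystem_iff.2 ⟨0,
        (a p * fderiv ℝ a p v + b p * fderiv ℝ b p v) / (a p ^ 2 + b p ^ 2), rfl⟩, fun w => ?_⟩
      refine (hF.dForm_charFrame_one hp (ha p hp) (hb p hp) v w).trans ?_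
      simp only [hω, hv, Matrix.cons_val, add_apply, smul_apply, smul_eq_mul]
      field_simp
      linear_combination (b p * pullback i theta2 p w * (-1) + a p * pullback i theta3 p w) * hdv

theorem classAt_add_finrank_cauchyChar (S : Set Par) (M : Par → Submodule ℝ (Par →L[ℝ] ℝ))
    (p : Par) :
    classAt S M p + finrank ℝ (cauchyChar S M p) = 7 := by
  let e : (Par →L[ℝ] ℝ) ≃ₗ[ℝ] Dual ℝ Par := LinearMap.toContinuousLinearMap.symm
  have h : (cartanSystem S M p).map (e : (Par →L[ℝ] ℝ) →ₗ[ℝ] Dual ℝ Par) =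
      (cauchyChar S M p).dualAnnihilator := by
    ext f
    rw [Submodule.mem_dualAnnihilator]
    constructor
    · rintro ⟨α, hα, rfl⟩ v hv
      exact hα v hv
    · intro hf
      exact ⟨e.symm f, fun v hv => hf v hv, e.apply_symm_apply f⟩
  have h1 := Subspace.finrank_add_finrank_dualAnnihilator_eq (cauchyChar S M p)
  rw [← h, LinearEquiv.finrank_map_eq] at h1
  unfold classAt
  rw [add_comm, h1]
  simp

/-- The class of `⟨ω¹, a ω² + b ω³⟩`. -/
theorem IsHyperbolic.classAt_charSystem (hF : IsHyperbolic F D S i) (hp : p ∈ S)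
    (ha : ∀ q ∈ S, ContDiffAt ℝ ∞ a q) (hb : ∀ q ∈ S, ContDiffAt ℝ ∞ b q)
    (hab : a p ≠ 0 ∨ b p ≠ 0) (hM : M =ᶠ[𝓝 p] charSystem i a b)
    {v : Par} (hv : fderiv ℝ i p v = ![0, 0, 0, 0, 0, b p ^ 2, -(a p * b p), a p ^ 2]) :
    (a p * fderiv ℝ b p v = b p * fderiv ℝ a p v → classAt S M p = 6) ∧
      (a p * fderiv ℝ b p v ≠ b p * fderiv ℝ a p v → classAt S M p = 7) := by
  have hsum := classAt_add_finrank_cauchyChar S M p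
  have hsub : ∀ w ∈ cauchyChar S M p, (∃ m : ℝ, m • v = w) ∧
      a p * fderiv ℝ b p w = b p * fderiv ℝ a p w := by
    intro w hw
    obtain ⟨⟨m, hm⟩, h⟩ := hF.cauchyChar_subset hp ha hb hab hM hw
    refine ⟨⟨m, hF.maxRank p hp ?_⟩, h⟩
    rw [map_smul, hv, hm]
  have hv0 : v ≠ 0 := by
    rintro rfl
    rw [map_zero] at hv
    have h5 := congrFun hv 5
    have h7 := congrFun hv 7
    simp at h5 h7
    exact (sq_add_sq_pos hab).ne (by linarith)
  constructor
  · intro h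
    have hvm := hF.mem_cauchyChar_of_vertical hp ha hb hab hM hv h
    have hs : cauchyChar S M p = Submodule.span ℝ {v} := by
      refine le_antisymm (fun w hw => ?_) ?_
      · exact Submodule.mem_span_singleton.2 (hsub w hw).1
      · exact (Submodule.span_singleton_le_iff_mem _ _).2 hvm
    rw [hs, finrank_span_singleton hv0] at hsum
    omega
  · intro h
    have hs : cauchyChar S M p = ⊥ := by
      rw [eq_bot_iff]
      intro w hw
      obtain ⟨⟨m, rfl⟩, hw'⟩ := hsub w hw
      rw [map_smul, map_smul, smul_eq_mul, smul_eq_mul] at hw'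
      have hm : m * (a p * fderiv ℝ b p v - b p * fderiv ℝ a p v) = 0 := by linear_combination hw'
      rw [(mul_eq_zero.1 hm).resolve_right (sub_ne_zero.2 h), zero_smul]
      exact zero_mem _
    rw [hs, finrank_bot] at hsum
    omega

end

/-! ### Roots of the symbol, the two systems and the invariants. -/

section

variable {F : Jet2 → ℝ} {D : Set Jet2} {S : Set Par} {i : Par → Jet2} {p : Par}
  {M M₁ M₂ : Par → Submodule ℝ (Par →L[ℝ] ℝ)}

theorem contDiffAt_pd {G : Jet2 → ℝ} {x : Jet2} (h : ContDiffAt ℝ ∞ G x) (k : Fin 8) :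
    ContDiffAt ℝ ∞ (pd k G) x :=
  (h.fderiv_right (m := ∞) (by simp)).clm_apply contDiffAt_const

/-- `λ₊` is the larger root of `λ² - F_s λ + F_r F_t`, whose discriminant is `-4Δ`. -/
theorem lamPlus_sq {x : Jet2} (h : discr F x < 0) :
    lamPlus F x ^ 2 + pr F x * pt F x = ps F x * lamPlus F x := by
  have h1 : √|discr F x| ^ 2 = -discr F x := by
    rw [Real.sq_sqrt (abs_nonneg _), abs_of_neg h]
  unfold lamPlus
  unfold discr at h1 ⊢
  linear_combination h1

theorem lamPlus_pos {x : Jet2} (h : discr F x < 0) (hs : 0 ≤ ps F x) : 0 < lamPlus F x := by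
  have := Real.sqrt_pos.2 (abs_pos.2 h.ne)
  unfold lamPlus
  positivity

theorem contDiffAt_lamPlus {x : Jet2} (hF : ContDiffAt ℝ ∞ F x) (h : discr F x < 0) :
    ContDiffAt ℝ ∞ (lamPlus F) x := by
  have hr := contDiffAt_pd hF 5
  have hs := contDiffAt_pd hF 6
  have ht := contDiffAt_pd hF 7
  have hd : ContDiffAt ℝ ∞ (discr F) x :=
    (hr.mul ht).sub (contDiffAt_const.mul (hs.pow 2))
  have habs : ContDiffAt ℝ ∞ (fun x => |discr F x|) x := (contDiffAt_abs h.ne).comp x hd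
  exact (hs.div_const 2).add (habs.sqrt (abs_pos.2 h.ne).ne')

theorem contDiffAt_ratioT {x : Jet2} (hF : ContDiffAt ℝ ∞ F x) (h : discr F x < 0)
    (hs : 0 ≤ ps F x) : ContDiffAt ℝ ∞ (ratioT F) x :=
  (contDiffAt_pd hF 7).div (contDiffAt_lamPlus hF h) (lamPlus_pos h hs).ne'

theorem contDiffAt_ratioR {x : Jet2} (hF : ContDiffAt ℝ ∞ F x) (h : discr F x < 0)
    (hs : 0 ≤ ps F x) : ContDiffAt ℝ ∞ (ratioR F) x :=
  (contDiffAt_pd hF 5).div (contDiffAt_lamPlus hF h) (lamPlus_pos h hs).ne'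

theorem lamPlus_mul_ratioT {x : Jet2} (h : discr F x < 0) (hs : 0 ≤ ps F x) :
    lamPlus F x * ratioT F x = pt F x := mul_div_cancel₀ _ (lamPlus_pos h hs).ne'

theorem lamPlus_mul_ratioR {x : Jet2} (h : discr F x < 0) (hs : 0 ≤ ps F x) :
    lamPlus F x * ratioR F x = pr F x := mul_div_cancel₀ _ (lamPlus_pos h hs).ne'

theorem lamPlus_mul_add_one {x : Jet2} (h : discr F x < 0) (hs : 0 ≤ ps F x) :
    lamPlus F x * (ratioR F x * ratioT F x + 1) = ps F x := by
  have h0 := (lamPlus_pos h hs).ne'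
  refine mul_left_cancel₀ h0 ?_
  have h1 := lamPlus_sq h
  rw [← lamPlus_mul_ratioT h hs, ← lamPlus_mul_ratioR h hs] at h1
  linear_combination h1

/-- In terms of `λ₊` and the ratios `ρ, τ`, `4Δ = -λ₊² (ρτ - 1)²`. -/
theorem ratioR_mul_ratioT_ne_one {x : Jet2} (h : discr F x < 0) (hs : 0 ≤ ps F x) :
    ratioR F x * ratioT F x ≠ 1 := by
  intro h1
  have h2 := lamPlus_mul_add_one h hs
  have h3 := h
  rw [h1] at h2
  rw [discr, ← h2, ← lamPlus_mul_ratioT h hs, ← lamPlus_mul_ratioR h hs] at h3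
  have : lamPlus F x * ratioR F x * (lamPlus F x * ratioT F x) -
      1 / 4 * (lamPlus F x * (1 + 1)) ^ 2 = 0 := by linear_combination lamPlus F x ^ 2 * h1
  linarith

/-- The two factors cut out the null lines through `(1, τ)` and `(ρ, 1)`. Normalizing one entry to 1
in each avoids dividing by `F_r` or `F_t`, either of which may vanish. -/
theorem symbol_factorization {x : Jet2} (h : discr F x < 0) (hs : 0 ≤ ps F x) (a b : ℝ) :
    pt F x * a ^ 2 - ps F x * a * b + pr F x * b ^ 2 =
      lamPlus F x * ((ratioT F x * a - b) * (a - ratioR F x * b)) := by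
  rw [← lamPlus_mul_ratioT h hs, ← lamPlus_mul_ratioR h hs, ← lamPlus_mul_add_one h hs]
  ring

/-- The system `⟨ω¹, ω² + (F_t / λ₊) ω³⟩`. -/
def charSystemT (F : Jet2 → ℝ) (i : Par → Jet2) : Par → Submodule ℝ (Par →L[ℝ] ℝ) :=
  charSystem i (fun _ => 1) fun q => ratioT F (i q)

/-- The system `⟨ω¹, (F_r / λ₊) ω² + ω³⟩`. -/
def charSystemR (F : Jet2 → ℝ) (i : Par → Jet2) : Par → Submodule ℝ (Par →L[ℝ] ℝ) :=
  charSystem i (fun q => ratioR F (i q)) fun _ => 1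

theorem contDiffAt_ratioT_par (hF : IsHyperbolic F D S i) (hs : ∀ p ∈ S, 0 ≤ ps F (i p))
    (hp : p ∈ S) : ContDiffAt ℝ ∞ (fun q => ratioT F (i q)) p :=
  (contDiffAt_ratioT (hF.contDiffAt_fun hp) (hF.discr_neg p hp) (hs p hp)).comp p
    (hF.contDiffAt_par hp)

theorem contDiffAt_ratioR_par (hF : IsHyperbolic F D S i) (hs : ∀ p ∈ S, 0 ≤ ps F (i p))
    (hp : p ∈ S) : ContDiffAt ℝ ∞ (fun q => ratioR F (i q)) p :=
  (contDiffAt_ratioR (hF.contDiffAt_fun hp) (hF.discr_neg p hp) (hs p hp)).comp p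
    (hF.contDiffAt_par hp)

theorem isIsotropic_charSystemT (hF : IsHyperbolic F D S i)
    (hs : ∀ p ∈ S, 0 ≤ ps F (i p)) : IsIsotropic S i (charSystemT F i) :=
  hF.isIsotropic_charSystem (fun _ _ => contDiffAt_const)
    (fun _ hp => contDiffAt_ratioT_par hF hs hp) (fun _ _ => Or.inl one_ne_zero) fun p hp => by
      rw [symbol_factorization (hF.discr_neg p hp) (hs p hp)]; ring

theorem isIsotropic_charSystemR (hF : IsHyperbolic F D S i)
    (hs : ∀ p ∈ S, 0 ≤ ps F (i p)) : IsIsotropic S i (charSystemR F i) :=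
  hF.isIsotropic_charSystem (fun _ hp => contDiffAt_ratioR_par hF hs hp)
    (fun _ _ => contDiffAt_const) (fun _ _ => Or.inr one_ne_zero) fun p hp => by
      rw [symbol_factorization (hF.discr_neg p hp) (hs p hp)]; ring

theorem charSystemT_ne_charSystemR (hF : IsHyperbolic F D S i) (hs : ∀ p ∈ S, 0 ≤ ps F (i p))
    (hp : p ∈ S) : charSystemT F i p ≠ charSystemR F i p := by
  intro h
  -- The generator `ω² + τ ω³` of the first system belongs to the second only if `ρτ = 1`.
  have h1 := hF.sum_mem_charSystem_iff (a := fun q => ratioR F (i q)) (b := fun _ => 1) hp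
    (Or.inr one_ne_zero) ![0, 1, ratioT F (i p)]
  have h2 := hF.sum_mem_charSystem_iff (a := fun _ => 1) (b := fun q => ratioT F (i q)) hp
    (Or.inl one_ne_zero) ![0, 1, ratioT F (i p)]
  rw [charSystemT, charSystemR] at h
  rw [h] at h2
  have h3 := h1.1 (h2.2 (by simp))
  simp at h3
  exact ratioR_mul_ratioT_ne_one (hF.discr_neg p hp) (hs p hp) h3.symm

theorem isCharPair_charSystems (hF : IsHyperbolic F D S i)
    (hs : ∀ p ∈ S, 0 ≤ ps F (i p)) : IsCharPair S i (charSystemT F i) (charSystemR F i) :=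
  ⟨isIsotropic_charSystemT hF hs, isIsotropic_charSystemR hF hs,
    fun _ hp => charSystemT_ne_charSystemR hF hs hp⟩

/-- There are at most two isotropic rank two subsystems at each point. -/
theorem IsIsotropic.eq_or_eq (hF : IsHyperbolic F D S i) (hs : ∀ p ∈ S, 0 ≤ ps F (i p))
    (hM : IsIsotropic S i M) (hp : p ∈ S) :
    M p = charSystemT F i p ∨ M p = charSystemR F i p := by
  have hfr := finrank_eq_of_isPfaffian hM.pfaffian hp
  obtain ⟨V, hV, hpV, hVS, η, hη, h⟩ := hM.pfaffian p hp
  obtain ⟨m, hm, hform⟩ := hF.exists_form7_eq hp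
  -- Every covector of `M p` extends to a section with constant frame coefficients, hence is null
  -- and lies in one of two planes. A subgroup contained in a union of two subgroups lies in one of
  -- them.
  have hsub : (M p : Set (Par →L[ℝ] ℝ)) ⊆ charSystemT F i p ∪ charSystemR F i p := by
    intro α hα
    rw [SetLike.mem_coe, (h p hpV).2, Submodule.mem_span_range_iff_exists_fun] at hα
    obtain ⟨k, rfl⟩ := hα
    have hsec : IsSection M V fun q => ∑ j, k j • η j q :=
      ⟨ContDiffOn.sum fun j _ => (hη j).const_smul (k j), fun q hq => by
        rw [(h q hq).2]
        exact sum_mem fun j _ => Submodule.smul_mem _ _ (Submodule.subset_span ⟨j, rfl⟩)⟩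
    obtain ⟨c, hc, hc'⟩ := hF.exists_contact_coeffs hp (hsec.contDiffAt hV hpV) (by
      filter_upwards [hV.mem_nhds hpV] with q hq using hM.le_contact q (hVS hq) (hsec.2 q hq))
    have h0 := hM.isotropic V hV hVS _ _ hsec hsec p hpV
    rw [hform hc hc hc' hc'] at h0
    have h1 := symbol_factorization (hF.discr_neg p hp) (hs p hp) (c 1 p) (c 2 p)
    have h2 : (ratioT F (i p) * c 1 p - c 2 p) * (c 1 p - ratioR F (i p) * c 2 p) = 0 := by
      refine (mul_eq_zero.1 (?_ : (2 * m * lamPlus F (i p)) * _ = 0)).resolve_left ?_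
      · linear_combination h0 - 2 * m * h1
      · exact mul_ne_zero (mul_ne_zero two_ne_zero hm)
          (lamPlus_pos (hF.discr_neg p hp) (hs p hp)).ne'
    have h3 : ∑ j, k j • η j p = ∑ j, c j p • contactFrame i j p := hc'.self_of_nhds
    rw [h3]
    rcases mul_eq_zero.1 h2 with h2 | h2
    · refine Or.inl ((hF.sum_mem_charSystem_iff hp (Or.inl one_ne_zero) fun j => c j p).2 ?_)
      linear_combination h2
    · refine Or.inr ((hF.sum_mem_charSystem_iff hp (Or.inr one_ne_zero) fun j => c j p).2 ?_)
      linear_combination h2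
  rcases AddSubgroupClass.subset_union.1 hsub with h | h
  · refine Or.inl (Submodule.eq_of_le_of_finrank_eq h ?_)
    rw [hfr, charSystemT, hF.finrank_charSystem hp (Or.inl one_ne_zero)]
  · refine Or.inr (Submodule.eq_of_le_of_finrank_eq h ?_)
    rw [hfr, charSystemR, hF.finrank_charSystem hp (Or.inr one_ne_zero)]

/-- Being different from the other system is an open condition, and only two choices exist at each
point. Agreement of germs is needed because the class involves derivatives of sections. -/
theorem IsIsotropic.eventuallyEq_charSystemT (hF : IsHyperbolic F D S i)
    (hs : ∀ p ∈ S, 0 ≤ ps F (i p))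
    (hM : IsIsotropic S i M) (hp : p ∈ S)
    (h : M p = charSystemT F i p) : M =ᶠ[𝓝 p] charSystemT F i := by
  have hne := hF.eventually_ne_charSystem hp hM (contDiffAt_ratioR_par hF hs hp).continuousAt
    continuousAt_const (fun _ _ => Or.inr one_ne_zero) (h ▸ charSystemT_ne_charSystemR hF hs hp)
  filter_upwards [hne, hF.isOpen_par.mem_nhds hp] with q hq hqS
  exact (IsIsotropic.eq_or_eq hF hs hM hqS).resolve_right hq

theorem IsIsotropic.eventuallyEq_charSystemR (hF : IsHyperbolic F D S i)
    (hs : ∀ p ∈ S, 0 ≤ ps F (i p))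
    (hM : IsIsotropic S i M) (hp : p ∈ S)
    (h : M p = charSystemR F i p) : M =ᶠ[𝓝 p] charSystemR F i := by
  have hne := hF.eventually_ne_charSystem hp hM continuousAt_const
    (contDiffAt_ratioT_par hF hs hp).continuousAt (fun _ _ => Or.inl one_ne_zero)
    (h ▸ (charSystemT_ne_charSystemR hF hs hp).symm)
  filter_upwards [hne, hF.isOpen_par.mem_nhds hp] with q hq hqS
  exact (IsIsotropic.eq_or_eq hF hs hM hqS).resolve_left hq

/-- `I₁` is a derivative of `F_t / λ₊` along a vertical vector tangent to the equation. -/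
theorem exists_I1_eq (hF : IsHyperbolic F D S i) (hs : ∀ p ∈ S, 0 ≤ ps F (i p))
    (hp : p ∈ S) : ∃ v,
    fderiv ℝ i p v = ![0, 0, 0, 0, 0, ratioT F (i p) ^ 2, -(1 * ratioT F (i p)), 1 ^ 2] ∧
      I1 F i p = -lamPlus F (i p) ^ 2 * fderiv ℝ (fun q => ratioT F (i q)) p v := by
  have hd := hF.discr_neg p hp
  have h1 := lamPlus_mul_ratioT hd (hs p hp)
  have h2 := lamPlus_mul_ratioR hd (hs p hp)
  have h3 := lamPlus_mul_add_one hd (hs p hp)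
  obtain ⟨v, hv⟩ := hF.exists_vertical hp (r := ratioT F (i p) ^ 2)
    (s := -(1 * ratioT F (i p))) (t := 1 ^ 2) (by
      rw [← h1, ← h2, ← h3]; ring)
  refine ⟨v, hv, ?_⟩
  have h4 : HasFDerivAt (fun q => ratioT F (i q)) _ p :=
    ((contDiffAt_ratioT (hF.contDiffAt_fun hp) hd (hs p hp)).differentiableAt
      (by simp)).hasFDerivAt.comp p ((hF.contDiffAt_par hp).differentiableAt (by simp)).hasFDerivAt
  rw [h4.fderiv, ContinuousLinearMap.comp_apply, hv, fderiv_eq_sum_pd, Fin.sum_univ_eight]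
  -- The cofactors of the last row are `-λ₊² (τ², -τ, 1)`, a multiple of the fibre components of
  -- `v`.
  simp only [I1, tildeI1, Matrix.det_fin_three, Matrix.of_apply, Matrix.cons_val]
  rw [← h1, ← h2, ← h3]
  ring

/-- `I₂` is a derivative of `F_r / λ₊` along a vertical vector tangent to the equation. -/
theorem exists_I2_eq (hF : IsHyperbolic F D S i) (hs : ∀ p ∈ S, 0 ≤ ps F (i p))
    (hp : p ∈ S) : ∃ v,
    fderiv ℝ i p v = ![0, 0, 0, 0, 0, 1 ^ 2, -(ratioR F (i p) * 1), ratioR F (i p) ^ 2] ∧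
      I2 F i p = -lamPlus F (i p) ^ 2 * fderiv ℝ (fun q => ratioR F (i q)) p v := by
  have hd := hF.discr_neg p hp
  have h1 := lamPlus_mul_ratioT hd (hs p hp)
  have h2 := lamPlus_mul_ratioR hd (hs p hp)
  have h3 := lamPlus_mul_add_one hd (hs p hp)
  obtain ⟨v, hv⟩ := hF.exists_vertical hp (r := 1 ^ 2)
    (s := -(ratioR F (i p) * 1)) (t := ratioR F (i p) ^ 2) (by
      rw [← h1, ← h2, ← h3]; ring)
  refine ⟨v, hv, ?_⟩
  have h4 : HasFDerivAt (fun q => ratioR F (i q)) _ p :=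
    ((contDiffAt_ratioR (hF.contDiffAt_fun hp) hd (hs p hp)).differentiableAt
      (by simp)).hasFDerivAt.comp p ((hF.contDiffAt_par hp).differentiableAt (by simp)).hasFDerivAt
  rw [h4.fderiv, ContinuousLinearMap.comp_apply, hv, fderiv_eq_sum_pd, Fin.sum_univ_eight]
  -- Here the cofactors of the last row are `-λ₊² (1, -ρ, ρ²)`.
  simp only [I2, tildeI2, Matrix.det_fin_three, Matrix.of_apply, Matrix.cons_val]
  rw [← h1, ← h2, ← h3]
  ring

theorem classAt_charSystemT (hF : IsHyperbolic F D S i) (hs : ∀ p ∈ S, 0 ≤ ps F (i p))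
    (hp : p ∈ S) (hM : M =ᶠ[𝓝 p] charSystemT F i) :
    classAt S M p = if I1 F i p = 0 then 6 else 7 := by
  obtain ⟨v, hv, hI⟩ := exists_I1_eq hF hs hp
  have h := hF.classAt_charSystem hp (fun _ _ => contDiffAt_const)
    (fun _ hp => contDiffAt_ratioT_par hF hs hp) (Or.inl one_ne_zero) hM hv
  have h0 := (lamPlus_pos (hF.discr_neg p hp) (hs p hp)).ne'
  simp only [fderiv_fun_const, Pi.zero_apply, zero_apply, mul_zero, one_mul] at h
  split_ifs with h1
  · refine h.1 ((mul_eq_zero.1 (hI.symm.trans h1)).resolve_left ?_)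
    exact neg_ne_zero.2 (pow_ne_zero 2 h0)
  · exact h.2 fun h2 => h1 (by rw [hI, h2, mul_zero])

theorem classAt_charSystemR (hF : IsHyperbolic F D S i) (hs : ∀ p ∈ S, 0 ≤ ps F (i p))
    (hp : p ∈ S) (hM : M =ᶠ[𝓝 p] charSystemR F i) :
    classAt S M p = if I2 F i p = 0 then 6 else 7 := by
  obtain ⟨v, hv, hI⟩ := exists_I2_eq hF hs hp
  have h := hF.classAt_charSystem hp (fun _ hp => contDiffAt_ratioR_par hF hs hp)
    (fun _ _ => contDiffAt_const) (Or.inr one_ne_zero) hM hv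
  have h0 := (lamPlus_pos (hF.discr_neg p hp) (hs p hp)).ne'
  simp only [fderiv_fun_const, Pi.zero_apply, zero_apply, mul_zero, one_mul] at h
  split_ifs with h1
  · refine h.1 ((mul_eq_zero.1 (hI.symm.trans h1)).resolve_left ?_).symm
    exact neg_ne_zero.2 (pow_ne_zero 2 h0)
  · exact h.2 fun h2 => h1 (by rw [hI, ← h2, mul_zero])

theorem IsCharPair.eventuallyEq (hF : IsHyperbolic F D S i) (hs : ∀ p ∈ S, 0 ≤ ps F (i p))
    (h : IsCharPair S i M₁ M₂) (hp : p ∈ S) :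
    (M₁ =ᶠ[𝓝 p] charSystemT F i ∧ M₂ =ᶠ[𝓝 p] charSystemR F i) ∨
      (M₁ =ᶠ[𝓝 p] charSystemR F i ∧ M₂ =ᶠ[𝓝 p] charSystemT F i) := by
  have h1 := h.isotropic_fst
  have h2 := h.isotropic_snd
  have hne := h.distinct p hp
  rcases IsIsotropic.eq_or_eq hF hs h1 hp with e1 | e1 <;>
    rcases IsIsotropic.eq_or_eq hF hs h2 hp with e2 | e2
  · exact absurd (e1.trans e2.symm) hne
  · exact Or.inl ⟨IsIsotropic.eventuallyEq_charSystemT hF hs h1 hp e1,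
      IsIsotropic.eventuallyEq_charSystemR hF hs h2 hp e2⟩
  · exact Or.inr ⟨IsIsotropic.eventuallyEq_charSystemR hF hs h1 hp e1,
      IsIsotropic.eventuallyEq_charSystemT hF hs h2 hp e2⟩
  · exact absurd (e1.trans e2.symm) hne

/-- Each of the two labellings holds on an open set. These sets cover `S` and do not meet in it, so
connectedness excludes a switch. -/
theorem IsCharPair.forall_eventuallyEq (hF : IsHyperbolic F D S i) (hs : ∀ p ∈ S, 0 ≤ ps F (i p))
    (h : IsCharPair S i M₁ M₂) (hS : IsPreconnected S) :
    (∀ p ∈ S, M₁ =ᶠ[𝓝 p] charSystemT F i ∧ M₂ =ᶠ[𝓝 p] charSystemR F i) ∨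
      (∀ p ∈ S, M₁ =ᶠ[𝓝 p] charSystemR F i ∧ M₂ =ᶠ[𝓝 p] charSystemT F i) := by
  have hopen : ∀ N N' : Par → Submodule ℝ (Par →L[ℝ] ℝ),
      IsOpen {p | M₁ =ᶠ[𝓝 p] N ∧ M₂ =ᶠ[𝓝 p] N'} := fun N N' =>
    isOpen_setOfPred_eventually_nhds.inter isOpen_setOfPred_eventually_nhds
  refine isPreconnected_iff_subset_of_disjoint.1 hS _ _
    (hopen (charSystemT F i) (charSystemR F i)) (hopen (charSystemR F i) (charSystemT F i))
    (fun p hp => IsCharPair.eventuallyEq hF hs h hp) ?_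
  rw [Set.eq_empty_iff_forall_notMem]
  rintro p ⟨hp, h1, h2⟩
  exact charSystemT_ne_charSystemR hF hs hp
    (h1.1.self_of_nhds.symm.trans h2.1.self_of_nhds)

theorem IsCharPair.classAt_eq (hF : IsHyperbolic F D S i) (hs : ∀ p ∈ S, 0 ≤ ps F (i p))
    (h : IsCharPair S i M₁ M₂) (hp : p ∈ S) :
    (classAt S M₁ p = (if I1 F i p = 0 then 6 else 7) ∧
        classAt S M₂ p = if I2 F i p = 0 then 6 else 7) ∨
      (classAt S M₁ p = (if I2 F i p = 0 then 6 else 7) ∧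
        classAt S M₂ p = if I1 F i p = 0 then 6 else 7) :=
  (IsCharPair.eventuallyEq hF hs h hp).imp
    (fun h => ⟨classAt_charSystemT hF hs hp h.1, classAt_charSystemR hF hs hp h.2⟩)
    (fun h => ⟨classAt_charSystemR hF hs hp h.1, classAt_charSystemT hF hs hp h.2⟩)

theorem IsCharPair.isMongeAmpereAt_iff (hF : IsHyperbolic F D S i) (hs : ∀ p ∈ S, 0 ≤ ps F (i p))
    (h : IsCharPair S i M₁ M₂) (hp : p ∈ S) :
    IsMongeAmpereAt S M₁ M₂ p ↔ I1 F i p = 0 ∧ I2 F i p = 0 := by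
  unfold IsMongeAmpereAt
  rcases IsCharPair.classAt_eq hF hs h hp with ⟨h1, h2⟩ | ⟨h1, h2⟩ <;> rw [h1, h2] <;>
    by_cases a1 : I1 F i p = 0 <;> by_cases a2 : I2 F i p = 0 <;> simp [a1, a2]

theorem IsCharPair.isGenericAt_iff (hF : IsHyperbolic F D S i) (hs : ∀ p ∈ S, 0 ≤ ps F (i p))
    (h : IsCharPair S i M₁ M₂) (hp : p ∈ S) :
    IsGenericAt S M₁ M₂ p ↔ I1 F i p * I2 F i p ≠ 0 := by
  unfold IsGenericAt
  rcases IsCharPair.classAt_eq hF hs h hp with ⟨h1, h2⟩ | ⟨h1, h2⟩ <;> rw [h1, h2] <;>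
    by_cases a1 : I1 F i p = 0 <;> by_cases a2 : I2 F i p = 0 <;> simp [a1, a2]

theorem IsCharPair.isGoursatAt_iff (hF : IsHyperbolic F D S i) (hs : ∀ p ∈ S, 0 ≤ ps F (i p))
    (h : IsCharPair S i M₁ M₂) (hp : p ∈ S) :
    IsGoursatAt S M₁ M₂ p ↔ Xor (I1 F i p = 0) (I2 F i p = 0) := by
  unfold IsGoursatAt
  rw [Set.pair_eq_pair_iff]
  rcases IsCharPair.classAt_eq hF hs h hp with ⟨h1, h2⟩ | ⟨h1, h2⟩ <;> rw [h1, h2] <;>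
    by_cases a1 : I1 F i p = 0 <;> by_cases a2 : I2 F i p = 0 <;> simp [a1, a2, Xor]

theorem IsCharPair.isGoursat_iff (hF : IsHyperbolic F D S i) (hs : ∀ p ∈ S, 0 ≤ ps F (i p))
    (h : IsCharPair S i M₁ M₂) (hS : IsPreconnected S) :
    IsGoursat S M₁ M₂ ↔
      ((∀ p ∈ S, I1 F i p = 0) ∧ ∀ p ∈ S, I2 F i p ≠ 0) ∨
      ((∀ p ∈ S, I1 F i p ≠ 0) ∧ ∀ p ∈ S, I2 F i p = 0) := by
  have hT : ∀ {M : Par → Submodule ℝ (Par →L[ℝ] ℝ)}, (∀ p ∈ S, M =ᶠ[𝓝 p] charSystemT F i) →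
      (HasClass S M 6 ↔ ∀ p ∈ S, I1 F i p = 0) ∧ (HasClass S M 7 ↔ ∀ p ∈ S, I1 F i p ≠ 0) := by
    intro M hM
    constructor <;> refine forall₂_congr fun p hp => ?_ <;>
      rw [classAt_charSystemT hF hs hp (hM p hp)] <;> simp
  have hR : ∀ {M : Par → Submodule ℝ (Par →L[ℝ] ℝ)}, (∀ p ∈ S, M =ᶠ[𝓝 p] charSystemR F i) →
      (HasClass S M 6 ↔ ∀ p ∈ S, I2 F i p = 0) ∧ (HasClass S M 7 ↔ ∀ p ∈ S, I2 F i p ≠ 0) := by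
    intro M hM
    constructor <;> refine forall₂_congr fun p hp => ?_ <;>
      rw [classAt_charSystemR hF hs hp (hM p hp)] <;> simp
  unfold IsGoursat
  rcases IsCharPair.forall_eventuallyEq hF hs h hS with h1 | h1
  · rw [(hT fun p hp => (h1 p hp).1).1, (hT fun p hp => (h1 p hp).1).2,
      (hR fun p hp => (h1 p hp).2).1, (hR fun p hp => (h1 p hp).2).2]
  · rw [(hR fun p hp => (h1 p hp).1).1, (hR fun p hp => (h1 p hp).1).2,
      (hT fun p hp => (h1 p hp).2).1, (hT fun p hp => (h1 p hp).2).2]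
    tauto

/-! ### Rescaling the defining function. -/

section Scaling

variable {φ : Jet2 → ℝ}

theorem pd_mul_of_eq_zero {x : Jet2} (hφ : DifferentiableAt ℝ φ x) (hF : DifferentiableAt ℝ F x)
    (h0 : F x = 0) (k : Fin 8) : pd k (fun x => φ x * F x) x = φ x * pd k F x := by
  unfold pd
  rw [fderiv_fun_mul hφ hF]
  simp [h0]

theorem pd_mul_par (hF : IsHyperbolic F D S i) (hφ : ContDiffOn ℝ ∞ φ D)
    (hp : p ∈ S) (k : Fin 8) :
    pd k (fun x => φ x * F x) (i p) = φ (i p) * pd k F (i p) :=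
  pd_mul_of_eq_zero ((hφ.contDiffAt (hF.isOpen_dom.mem_nhds
    (hF.mem_locus p hp).1)).differentiableAt (by simp))
    ((hF.contDiffAt_fun hp).differentiableAt (by simp)) (hF.mem_locus p hp).2 k

theorem discr_mul_par (hF : IsHyperbolic F D S i) (hφ : ContDiffOn ℝ ∞ φ D)
    (hp : p ∈ S) :
    discr (fun x => φ x * F x) (i p) = φ (i p) ^ 2 * discr F (i p) := by
  simp only [discr, pr, ps, pt, pd_mul_par hF hφ hp]
  ring

theorem IsHyperbolic.mul_left (hF : IsHyperbolic F D S i) (hφ : ContDiffOn ℝ ∞ φ D)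
    (hpos : ∀ p ∈ S, 0 < φ (i p)) : IsHyperbolic (fun x => φ x * F x) D S i where
  isOpen_dom := hF.isOpen_dom
  smooth_fun := hφ.mul hF.smooth_fun
  isOpen_par := hF.isOpen_par
  smooth_par := hF.smooth_par
  mem_locus p hp := ⟨(hF.mem_locus p hp).1, by rw [(hF.mem_locus p hp).2, mul_zero]⟩
  maxRank := hF.maxRank
  transverse := hF.transverse
  discr_neg p hp := by
    rw [discr_mul_par hF hφ hp]
    exact mul_neg_of_pos_of_neg (pow_pos (hpos p hp) 2) (hF.discr_neg p hp)

theorem lamPlus_mul_par (hF : IsHyperbolic F D S i) (hφ : ContDiffOn ℝ ∞ φ D)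
    (hpos : ∀ p ∈ S, 0 < φ (i p))
    (hp : p ∈ S) :
    lamPlus (fun x => φ x * F x) (i p) = φ (i p) * lamPlus F (i p) := by
  rw [lamPlus, lamPlus, discr_mul_par hF hφ hp, ps, pd_mul_par hF hφ hp, abs_mul,
    abs_of_nonneg (sq_nonneg _), Real.sqrt_mul (sq_nonneg _), Real.sqrt_sq (hpos p hp).le]
  ring

theorem ratioT_mul_par (hF : IsHyperbolic F D S i) (hφ : ContDiffOn ℝ ∞ φ D)
    (hpos : ∀ p ∈ S, 0 < φ (i p))
    (hp : p ∈ S) :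
    ratioT (fun x => φ x * F x) (i p) = ratioT F (i p) := by
  rw [ratioT, ratioT, lamPlus_mul_par hF hφ hpos hp, pt, pd_mul_par hF hφ hp]
  exact mul_div_mul_left _ _ (hpos p hp).ne'

theorem ratioR_mul_par (hF : IsHyperbolic F D S i) (hφ : ContDiffOn ℝ ∞ φ D)
    (hpos : ∀ p ∈ S, 0 < φ (i p))
    (hp : p ∈ S) :
    ratioR (fun x => φ x * F x) (i p) = ratioR F (i p) := by
  rw [ratioR, ratioR, lamPlus_mul_par hF hφ hpos hp, pr, pd_mul_par hF hφ hp]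
  exact mul_div_mul_left _ _ (hpos p hp).ne'

theorem ps_mul_par_nonneg (hF : IsHyperbolic F D S i) (hφ : ContDiffOn ℝ ∞ φ D)
    (hpos : ∀ p ∈ S, 0 < φ (i p)) (hs : ∀ p ∈ S, 0 ≤ ps F (i p))
    (hp : p ∈ S) : 0 ≤ ps (fun x => φ x * F x) (i p) := by
  rw [ps, pd_mul_par hF hφ hp]
  exact mul_nonneg (hpos p hp).le (hs p hp)

/-- The ratios of `F` and `φF` are compared only along `i`. This suffices because `exists_I1_eq`
differentiates the ratio composed with `i`; injectivity identifies the two vectors, and `λ₊²`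
contributes `φ²`. -/
theorem I1_mul (hF : IsHyperbolic F D S i) (hφ : ContDiffOn ℝ ∞ φ D)
    (hpos : ∀ p ∈ S, 0 < φ (i p)) (hs : ∀ p ∈ S, 0 ≤ ps F (i p))
    (hp : p ∈ S) : I1 (fun x => φ x * F x) i p = φ (i p) ^ 2 * I1 F i p := by
  obtain ⟨v, hv, hI⟩ := exists_I1_eq hF hs hp
  obtain ⟨w, hw, hI'⟩ := exists_I1_eq (hF.mul_left hφ hpos)
    (fun _ hp => ps_mul_par_nonneg hF hφ hpos hs hp) hp
  have he : (fun q => ratioT (fun x => φ x * F x) (i q)) =ᶠ[𝓝 p] fun q => ratioT F (i q) := by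
    filter_upwards [hF.isOpen_par.mem_nhds hp] with q hq using ratioT_mul_par hF hφ hpos hq
  rw [ratioT_mul_par hF hφ hpos hp, ← hv] at hw
  rw [hI', hI, lamPlus_mul_par hF hφ hpos hp, he.fderiv_eq, hF.maxRank p hp hw]
  ring

theorem I2_mul (hF : IsHyperbolic F D S i) (hφ : ContDiffOn ℝ ∞ φ D)
    (hpos : ∀ p ∈ S, 0 < φ (i p)) (hs : ∀ p ∈ S, 0 ≤ ps F (i p))
    (hp : p ∈ S) : I2 (fun x => φ x * F x) i p = φ (i p) ^ 2 * I2 F i p := by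
  obtain ⟨v, hv, hI⟩ := exists_I2_eq hF hs hp
  obtain ⟨w, hw, hI'⟩ := exists_I2_eq (hF.mul_left hφ hpos)
    (fun _ hp => ps_mul_par_nonneg hF hφ hpos hs hp) hp
  have he : (fun q => ratioR (fun x => φ x * F x) (i q)) =ᶠ[𝓝 p] fun q => ratioR F (i q) := by
    filter_upwards [hF.isOpen_par.mem_nhds hp] with q hq using ratioR_mul_par hF hφ hpos hq
  rw [ratioR_mul_par hF hφ hpos hp, ← hv] at hw
  rw [hI', hI, lamPlus_mul_par hF hφ hpos hp, he.fderiv_eq, hF.maxRank p hp hw]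
  ring

end Scaling

end

end HypPDE

end

/-! ### The main theorem. -/

theorem mainTheorem4 (F : HypPDE.Jet2 → ℝ) (D : Set HypPDE.Jet2) (S : Set HypPDE.Par)
    (i : HypPDE.Par → HypPDE.Jet2) (hF : HypPDE.IsHyperbolic F D S i)
    (hFs : ∀ p ∈ S, 0 ≤ HypPDE.ps F (i p)) :
    -- the pair of maximally isotropic subsystems of `I_F` exists
    (∃ M₁ M₂, HypPDE.IsCharPair S i M₁ M₂) ∧
    -- the classification, at each point and on `S`, for every labelling of the pair
    (∀ M₁ M₂, HypPDE.IsCharPair S i M₁ M₂ →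
      (∀ p ∈ S,
        (HypPDE.IsMongeAmpereAt S M₁ M₂ p ↔ HypPDE.I1 F i p = 0 ∧ HypPDE.I2 F i p = 0) ∧
        (HypPDE.IsGoursatAt S M₁ M₂ p ↔ Xor (HypPDE.I1 F i p = 0) (HypPDE.I2 F i p = 0)) ∧
        (HypPDE.IsGenericAt S M₁ M₂ p ↔ HypPDE.I1 F i p * HypPDE.I2 F i p ≠ 0)) ∧
      (HypPDE.IsMongeAmpere S M₁ M₂ ↔ ∀ p ∈ S, HypPDE.I1 F i p = 0 ∧ HypPDE.I2 F i p = 0) ∧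
      (IsPreconnected S →
        (HypPDE.IsGoursat S M₁ M₂ ↔
          ((∀ p ∈ S, HypPDE.I1 F i p = 0) ∧ ∀ p ∈ S, HypPDE.I2 F i p ≠ 0) ∨
          ((∀ p ∈ S, HypPDE.I1 F i p ≠ 0) ∧ ∀ p ∈ S, HypPDE.I2 F i p = 0))) ∧
      (HypPDE.IsGeneric S M₁ M₂ ↔ ∀ p ∈ S, HypPDE.I1 F i p * HypPDE.I2 F i p ≠ 0)) ∧
    -- the scaling property
    (∀ φ : HypPDE.Jet2 → ℝ, ContDiffOn ℝ ∞ φ D → (∀ p ∈ S, 0 < φ (i p)) →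
      HypPDE.IsHyperbolic (fun x => φ x * F x) D S i ∧
      (∀ p ∈ S, 0 ≤ HypPDE.ps (fun x => φ x * F x) (i p)) ∧
      ∀ p ∈ S,
        HypPDE.I1 (fun x => φ x * F x) i p = φ (i p) ^ 2 * HypPDE.I1 F i p ∧
        HypPDE.I2 (fun x => φ x * F x) i p = φ (i p) ^ 2 * HypPDE.I2 F i p) := by
  refine ⟨⟨_, _, HypPDE.isCharPair_charSystems hF hFs⟩, fun M₁ M₂ h => ⟨fun p hp =>
    ⟨HypPDE.IsCharPair.isMongeAmpereAt_iff hF hFs h hp,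
      HypPDE.IsCharPair.isGoursatAt_iff hF hFs h hp,
      HypPDE.IsCharPair.isGenericAt_iff hF hFs h hp⟩, ?_,
    HypPDE.IsCharPair.isGoursat_iff hF hFs h, ?_⟩, fun φ hφ hpos =>
    ⟨hF.mul_left hφ hpos, fun p hp => HypPDE.ps_mul_par_nonneg hF hφ hpos hFs hp, fun p hp =>
      ⟨HypPDE.I1_mul hF hφ hpos hFs hp, HypPDE.I2_mul hF hφ hpos hFs hp⟩⟩⟩
  · refine Iff.trans ?_
      (forall₂_congr fun p hp => HypPDE.IsCharPair.isMongeAmpereAt_iff hF hFs h hp)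
    exact ⟨fun h p hp => ⟨h.1 p hp, h.2 p hp⟩, fun h => ⟨fun p hp => (h p hp).1,
      fun p hp => (h p hp).2⟩⟩
  · refine Iff.trans ?_ (forall₂_congr fun p hp => HypPDE.IsCharPair.isGenericAt_iff hF hFs h hp)
    exact ⟨fun h p hp => ⟨h.1 p hp, h.2 p hp⟩, fun h => ⟨fun p hp => (h p hp).1,
      fun p hp => (h p hp).2⟩⟩
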